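/- Let $\mathcal{X}$ be a measurable feature space, $\mathcal{Y}=\{1,\dots,k\}$, and let $(\boldsymbol{x},y)\in\mathcal{X}\times\mathcal{Y}$ have the probability distribution $p(\boldsymbol{x},y)$. Let $p(s=j)$, $j=1,\dots,k-1$, be a probability distribution. For $\bar Y\subset\mathcal{Y}$ put $\bar p(\boldsymbol{x},\bar Y\mid s=j)=\binom{k-1}{j}^{-1}\sum_{y\notin\bar Y}p(\boldsymbol{x},y)$ if $|\bar Y|=j$ and $0$ otherwise, and $\bar p(\boldsymbol{x},\bar Y)=\sum_{j=1}^{k-1}p(s=j)\,\bar p(\boldsymbol{x},\bar Y\mid s=j)$. Let $(\boldsymbol{x}_i,\bar Y_i)$, $i=1,\dots,n$ ($n\ge 1$), be drawn i.i.d. from $\bar p$, and let $n_j$ be the number of $i$ with $|\bar Y_i|=j$. Let $\mathcal{F}$ be a class of measurable functions $f:\mathcal{X}\to\mathbb{R}^k$ that is pointwise separable (some countable $\mathcal{F}_0\subset\mathcal{F}$ is such that every $f\in\mathcal{F}$ is a pointwise limit of a sequence in $\mathcal{F}_0$), and let $\mathcal{L}:\mathbb{R}^k\times\mathcal{Y}\to[0,\infty)$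 be a loss such that, for every $y\in\mathcal{Y}$, $\mathcal{L}(\cdot,y)$ is $\rho$-Lipschitz ($0<\rho<\infty$) for the Euclidean norm. Assume $C_{\mathcal{L}}=\sup_{\boldsymbol{x}\in\mathcal{X},f\in\mathcal{F},y\in\mathcal{Y}}\mathcal{L}(f(\boldsymbol{x}),y)<\infty$. Put $R(f)=\mathbb{E}_{p(\boldsymbol{x},y)}[\mathcal{L}(f(\boldsymbol{x}),y)]$, $$\bar{\mathcal{L}}_j(f(\boldsymbol{x}),\bar Y)=\sum_{y\notin\bar Y}\mathcal{L}(f(\boldsymbol{x}),y)-\frac{k-1-j}{j}\sum_{y'\in\bar Y}\mathcal{L}(f(\boldsymbol{x}),y'),\qquad \widehat R(f)=\sum_{j=1}^{k-1}\frac{p(s=j)}{n_j}\sum_{i:\,|\bar Y_i|=j}\bar{\mathcal{L}}_j(f(\boldsymbol{x}_i),\bar Y_i).$$ Let $f^\star\in\mathcal{F}$ minimize $R$ over $\mathcal{F}$ and let $\mathcal{G}_y=\{\boldsymbol{x}\mapsto f_y(\boldsymbol{x})\mid f\in\mathcal{F}\}$. For $m\ge 1$ let $$\mathfrak{R}_m(\mathcal{G}_y)=\mathbb{E}_{\boldsymbol{x}_1,\dots,\boldsymbol{x}_m\sim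 p(\boldsymbol{x})}\mathbb{E}_{\boldsymbol\sigma}\Big[\sup_{g\in\mathcal{G}_y}\frac1m\sum_{i=1}^m\sigma_i g(\boldsymbol{x}_i)\Big]\in[0,\infty],$$ where $\boldsymbol{\sigma}$ is uniform on $\{-1,1\}^m$. Then, for every $\delta>0$, with probability at least $1-\delta$, every minimizer $\widehat f$ of $\widehat R$ over $\mathcal{F}$ satisfies $$R(\widehat f)-R(f^\star)\le\sum_{j=1}^{k-1}p(s=j)\Big(\frac{4\sqrt2\,\rho k(k-1)}{j}\sum_{y=1}^k\mathfrak{R}_{n_j}(\mathcal{G}_y)+\frac{C_j}{\sqrt{n_j}}\Big),\qquad C_j=(4k-4j-2)\,C_{\mathcal{L}}\sqrt{\frac{\log\frac{2(k-1)}{\delta}}{2}}.$$ (Terms with $p(s=j)=0$ are $0$; if $n_j=0$ for some $j$ with $p(s=j)>0$, nothing is claimed unless $C_{\mathcal{L}}=0$, the right-hand side being $+\infty$.) Likewise, with probability at least $1-\delta$, every minimizer over $\mathcal{F}$ of the plug-in empirical risk $\frac1n\sum_{i=1}^n\bar{\mathcal{L}}_{|\bar Y_i|}(f(\boldsymbol{x}_i),\bar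 Y_i)$, in which $p(s=j)$ is approximated by $n_j/n$, satisfies the same inequality with $n_j/n$ in place of $p(s=j)$. Both assertions also hold when the sizes $s_1,\dots,s_n\in\{1,\dots,k-1\}$ are prescribed and the $(\boldsymbol{x}_i,\bar Y_i)$ are independent with laws $\bar p(\boldsymbol{x},\bar Y\mid s=s_i)$. -/

import Mathlib

open MeasureTheory Filter Topology
open scoped ENNReal NNReal

noncomputable section

namespace MCL

/-- Finite collections of labels carry the discrete σ-algebra. -/
instance instMeasurableSpaceLabelSet (k : ℕ) : MeasurableSpace (Finset (Fin k)) := ⊤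

/-- An example with multiple complementary labels: an instance together with its set of
complementary labels. -/
abbrev Example (X : Type*) (k : ℕ) : Type _ := X × Finset (Fin k)

/-- The classification risk `R(f) = E_{(x,y)∼D} [L(f(x), y)]`. -/
def risk {X : Type*} [MeasurableSpace X] {k : ℕ}
    (L : EuclideanSpace ℝ (Fin k) → Fin k → ℝ) (D : Measure (X × Fin k))
    (f : X → EuclideanSpace ℝ (Fin k)) : ℝ :=
  ∫ z, L (f z.1) z.2 ∂D

/-- The law of `(x, Ȳ)` given that the complementary label set has size `j`:
`p̄(x, Ȳ ∣ s = j) = (1 / (k-1 choose j)) ∑_{y ∉ Ȳ} p(x, y)` if `|Ȳ| = j`, and `0` otherwise.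
Here `(D.restrict {y-th slice}).map (x ↦ (x, Ȳ))` is the measure `p(·, y)` placed on the label
set `Ȳ`. -/
def condLaw {X : Type*} [MeasurableSpace X] {k : ℕ} (D : Measure (X × Fin k)) (j : ℕ) :
    Measure (Example X k) :=
  ((Nat.choose (k - 1) j : ℝ≥0∞)⁻¹) •
    ∑ Y ∈ (Finset.univ : Finset (Finset (Fin k))).filter (fun Y => Y.card = j),
      ∑ y ∈ Yᶜ, (D.restrict (Prod.snd ⁻¹' {y})).map (fun z => (z.1, Y))

/-- The law of one training example: `p̄(x, Ȳ) = ∑_{j=1}^{k-1} p(s = j) p̄(x, Ȳ ∣ s = j)`. -/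
def sampleLaw {X : Type*} [MeasurableSpace X] {k : ℕ} (D : Measure (X × Fin k))
    (p : ℕ → ℝ≥0) : Measure (Example X k) :=
  ∑ j ∈ Finset.Icc 1 (k - 1), (p j) • condLaw D j

/-- The loss of a prediction `v` against a complementary label set `Y` of size `j`:
`∑_{y ∉ Y} L(v, y) - ((k - 1 - j) / j) ∑_{y' ∈ Y} L(v, y')`. -/
def compLoss {k : ℕ} (L : EuclideanSpace ℝ (Fin k) → Fin k → ℝ)
    (v : EuclideanSpace ℝ (Fin k)) (Y : Finset (Fin k)) : ℝ :=
  ∑ y ∈ Yᶜ, L v y - (((k : ℝ) - 1 - (Y.card : ℝ)) / (Y.card : ℝ)) * ∑ y ∈ Y, L v y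

/-- The number `n_j` of examples of the sample whose complementary label set has size `j`. -/
def sizeCount {X : Type*} {k n : ℕ} (S : Fin n → Example X k) (j : ℕ) : ℕ :=
  (Finset.univ.filter (fun i => (S i).2.card = j)).card

/-- The empirical risk with weights `p(s = j)`:
`∑_{j=1}^{k-1} (p(s = j) / n_j) ∑_{i : |Ȳ_i| = j} L̄_j(f(x_i), Ȳ_i)`. -/
def empRisk {X : Type*} {k n : ℕ} (L : EuclideanSpace ℝ (Fin k) → Fin k → ℝ) (p : ℕ → ℝ≥0)
    (S : Fin n → Example X k) (f : X → EuclideanSpace ℝ (Fin k)) : ℝ :=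
  ∑ j ∈ Finset.Icc 1 (k - 1), ((p j : ℝ) / (sizeCount S j : ℝ)) *
    ∑ i ∈ Finset.univ.filter (fun i => (S i).2.card = j), compLoss L (f (S i).1) (S i).2

/-- The plug-in empirical risk, `p(s = j)` being approximated by `n_j / n`:
`(1 / n) ∑_{i=1}^n L̄_{|Ȳ_i|}(f(x_i), Ȳ_i)`. -/
def pluginRisk {X : Type*} {k n : ℕ} (L : EuclideanSpace ℝ (Fin k) → Fin k → ℝ)
    (S : Fin n → Example X k) (f : X → EuclideanSpace ℝ (Fin k)) : ℝ :=
  (1 / (n : ℝ)) * ∑ i, compLoss L (f (S i).1) (S i).2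

/-- The empirical frequencies `n_j / n` of the sizes of the complementary label sets. -/
def sizeFreq {X : Type*} {k n : ℕ} (S : Fin n → Example X k) (j : ℕ) : ℝ≥0 :=
  (sizeCount S j : ℝ≥0) / (n : ℝ≥0)

/-- `E_σ [sup_{h ∈ H} (1/n) ∑_i σ_i h(z_i)]`, the signs `σ` being uniform on `{-1, 1}^n`, as an
extended real number. -/
def signAverage {Z : Type*} {n : ℕ} (H : Set (Z → ℝ)) (z : Fin n → Z) : EReal :=
  (∑ σ : Fin n → ℤˣ, ⨆ h ∈ H, (((1 / (n : ℝ)) * ∑ i, ((σ i : ℤ) : ℝ) * h (z i) : ℝ) : EReal))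
    / (2 ^ n : EReal)

/-- The expected Rademacher complexity
`E_{z_1, …, z_n ∼ μ} E_σ [sup_{h ∈ H} (1/n) ∑_i σ_i h(z_i)]`, possibly `∞`. For a nonempty class
the inner expectation lies in `[0, ∞]`, so that `toENNReal` does not change it. -/
def rademacher {Z : Type*} [MeasurableSpace Z] (n : ℕ) (μ : Measure Z) (H : Set (Z → ℝ)) :
    ℝ≥0∞ :=
  ∫⁻ z, (signAverage H z).toENNReal ∂(Measure.pi (fun _ : Fin n => μ))

/-- The class `G_y = {x ↦ f_y(x) ∣ f ∈ F}`. -/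
def coordClass {X : Type*} {k : ℕ} (F : Set (X → EuclideanSpace ℝ (Fin k))) (y : Fin k) :
    Set (X → ℝ) :=
  {g | ∃ f ∈ F, g = fun x => f x y}

/-- A class of functions is pointwise separable if it has a countable subclass such that every
function of the class is the pointwise limit of a sequence from the subclass. This is the usual
condition under which suprema over the class are measurable. -/
def PointwiseSeparable {X E : Type*} [TopologicalSpace E] (F : Set (X → E)) : Prop :=
  ∃ F₀ ⊆ F, F₀.Countable ∧ ∀ f ∈ F, ∃ u : ℕ → X → E,
    (∀ m, u m ∈ F₀) ∧ ∀ x, Tendsto (fun m => u m x) atTop (𝓝 (f x))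

/-- `C_j = (4k - 4j - 2) C √(log (2(k-1)/δ) / 2)`. -/
def devConst (k j : ℕ) (C δ : ℝ) : ℝ :=
  (4 * (k : ℝ) - 4 * (j : ℝ) - 2) * C * √(Real.log (2 * ((k : ℝ) - 1) / δ) / 2)

/-- The estimation error bound
`∑_{j=1}^{k-1} w_j ((4√2 ρ k (k-1) / j) ∑_y 𝔑_{n_j}(G_y) + C_j / √n_j)`, with values in `[0, ∞]`;
it is `∞` if `C > 0`, `δ < 1` and `n_j = 0` for some `j` with `w_j > 0`. -/
def errorBound {X : Type*} [MeasurableSpace X] {k n : ℕ} (D : Measure (X × Fin k))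
    (F : Set (X → EuclideanSpace ℝ (Fin k))) (ρ : ℝ≥0) (C δ : ℝ) (w : ℕ → ℝ≥0)
    (S : Fin n → Example X k) : ℝ≥0∞ :=
  ∑ j ∈ Finset.Icc 1 (k - 1), (w j : ℝ≥0∞) *
    (ENNReal.ofReal (4 * √2 * (ρ : ℝ) * (k : ℝ) * ((k : ℝ) - 1) / (j : ℝ)) *
        ∑ y : Fin k, rademacher (sizeCount S j) D.fst (coordClass F y)
      + ENNReal.ofReal (devConst k j C δ) / ENNReal.ofReal (√(sizeCount S j : ℝ)))

/-- The samples for which some minimizer over `F` of the empirical risk with weights `p(s = j)`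
violates the estimation error bound. -/
def failure {X : Type*} [MeasurableSpace X] {k : ℕ} (n : ℕ)
    (L : EuclideanSpace ℝ (Fin k) → Fin k → ℝ) (D : Measure (X × Fin k))
    (F : Set (X → EuclideanSpace ℝ (Fin k))) (ρ : ℝ≥0) (C δ : ℝ) (p : ℕ → ℝ≥0)
    (fstar : X → EuclideanSpace ℝ (Fin k)) : Set (Fin n → Example X k) :=
  {S | ∃ fhat ∈ F, IsMinOn (empRisk L p S) F fhat ∧
    ¬ ENNReal.ofReal (risk L D fhat - risk L D fstar) ≤ errorBound D F ρ C δ p S}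

/-- The samples for which some minimizer over `F` of the plug-in empirical risk violates the
estimation error bound with `n_j / n` in place of `p(s = j)`. -/
def pluginFailure {X : Type*} [MeasurableSpace X] {k : ℕ} (n : ℕ)
    (L : EuclideanSpace ℝ (Fin k) → Fin k → ℝ) (D : Measure (X × Fin k))
    (F : Set (X → EuclideanSpace ℝ (Fin k))) (ρ : ℝ≥0) (C δ : ℝ)
    (fstar : X → EuclideanSpace ℝ (Fin k)) : Set (Fin n → Example X k) :=
  {S | ∃ fhat ∈ F, IsMinOn (pluginRisk L S) F fhat ∧
    ¬ ENNReal.ofReal (risk L D fhat - risk L D fstar) ≤ errorBound D F ρ C δ (sizeFreq S) S}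

end MCL

end

/-! The complementary loss is an unbiased estimate of the ordinary one: summed over the size-`j`
label sets avoiding `y`, it returns the loss at `y` times the number of such sets
(`sum_powersetCard_compLoss`, `integral_sizedLoss`). Hence for every `j` the risk is the mean of the
size-`j` loss under `condLaw D j`, and minimality of the empirical risk bounds `R(f̂) - R(f⋆)` by
the weighted sum over `j` of the deviations between true and empirical excess risk over `f⋆`
(`estimation_error_le`). Since excess losses are used, a one-sided uniform deviation bound for each
`j` is enough.

That bound is classical. McDiarmid's inequality reduces the supremum of the deviations to its mean,
symmetrization bounds the mean by twice a Rademacher average of the excess losses, and vector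
contraction passes to the coordinates of `f` at the cost of twice the Lipschitz constant `(2k - 2j -
1)ρ`. Contraction rests on Khintchine's inequality with constant `2` instead of the sharp `√2`; this
is harmless because `2k - 2j - 1 ≤ k(k - 1)/j`, so the total factor `4(2k - 2j - 1)ρ` stays below
the stated one. McDiarmid's inequality fails with probability at most `δ/(2(k - 1))` for each of the
`k - 1` sizes, which leaves `δ/2` in all.

Suprema are taken over finite classes, where they are measurable; continuity from below extends the
bound to sequences, and pointwise limits extend it to the separable class. The failure sets need not
be measurable: only monotonicity, subadditivity and outer-measure estimates are applied to them.

The sizes are prescribed first. Then the examples of size `j` form an i.i.d. sample of fixed length,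
and the frequencies `n_j / n` are constants, so the plug-in risk is a case of the weighted one. The
i.i.d. law is a mixture of such products, and a bound uniform in the sizes survives mixing. -/

namespace MCL

/-! ### Sign averages, Khintchine's inequality and vector contraction. -/

open Finset in
lemma expect_sign (g : ℤˣ → ℝ) : expect univ g = (g 1 + g (-1)) / 2 := by
  rw [Fintype.expect_eq_sum_div_card]
  rw [UnitsInt.univ, Finset.sum_insert (by decide)]
  simp

open Finset in
lemma expect_fin_cons {S : Type*} [Fintype S] {m : ℕ} (g : (Fin (m + 1) → S) → ℝ) :
    expect univ g = expect univ fun s : S => expect univ fun σ : Fin m → S =>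
      g (Fin.cons s σ : Fin (m + 1) → S) := by
  rw [← Finset.expect_product' univ univ (fun (s : S) (σ : Fin m → S) =>
    g (Fin.cons s σ : Fin (m + 1) → S)), Finset.univ_product_univ]
  exact (Fintype.expect_equiv (Fin.consEquiv fun _ => S) _ _ fun x => rfl).symm

open Finset in
lemma expect_comp_eval {κ S : Type*} [Fintype κ] [DecidableEq κ] [Fintype S] [Nonempty S]
    (y : κ) (g : S → ℝ) :
    expect univ (fun τ : κ → S => g (τ y)) = expect univ g := by
  have h := Fintype.expect_equiv (Equiv.funSplitAt y S) (fun τ : κ → S => g (τ y))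
    (fun q => g q.1) (fun τ => rfl)
  rw [h, ← Finset.univ_product_univ, Finset.expect_product' univ univ
    (fun (s : S) (_ : {j // j ≠ y} → S) => g s)]
  simp

/-- The sum of the entries of `v` with the signs `τ`. -/
def signSum {κ : Type*} [Fintype κ] (τ : κ → ℤˣ) (v : κ → ℝ) : ℝ :=
  ∑ y, ((τ y : ℤ) : ℝ) * v y

lemma signSum_cons {m : ℕ} (s : ℤˣ) (τ : Fin m → ℤˣ) (v : Fin (m + 1) → ℝ) :
    signSum (Fin.cons s τ : Fin (m + 1) → ℤˣ) v
      = ((s : ℤ) : ℝ) * v 0 + signSum τ (fun i => v i.succ) := by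
  simp [signSum, Fin.sum_univ_succ]

lemma signSum_neg {κ : Type*} [Fintype κ] (τ : κ → ℤˣ) (v : κ → ℝ) :
    signSum (-τ) v = - signSum τ v := by
  simp [signSum]

lemma signSum_sub {κ : Type*} [Fintype κ] (τ : κ → ℤˣ) (u v : κ → ℝ) :
    signSum τ (fun y => u y - v y) = signSum τ u - signSum τ v := by
  simp [signSum, mul_sub]

open Finset in
lemma expect_neg_signs {κ : Type*} [Fintype κ] [DecidableEq κ] (g : (κ → ℤˣ) → ℝ) :
    expect univ (fun τ => g (-τ)) = expect univ g :=
  Fintype.expect_equiv (Equiv.neg (κ → ℤˣ)) _ _ fun _ => rfl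

open Finset in
lemma expect_signSum {κ : Type*} [Fintype κ] [DecidableEq κ] (v : κ → ℝ) :
    expect univ (fun τ : κ → ℤˣ => signSum τ v) = 0 := by
  have h := expect_neg_signs fun τ : κ → ℤˣ => signSum τ v
  simp only [signSum_neg, Finset.expect_neg_distrib] at h
  linarith

open Finset in
lemma expect_signSum_sq : ∀ {m : ℕ} (v : Fin m → ℝ),
    expect univ (fun τ : Fin m → ℤˣ => signSum τ v ^ 2) = ∑ y, v y ^ 2
  | 0, v => by simp [signSum]
  | m + 1, v => by
    have ih := expect_signSum_sq fun i : Fin m => v i.succ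
    have h1 := expect_signSum fun i : Fin m => v i.succ
    rw [expect_fin_cons, expect_sign, Fin.sum_univ_succ, ← ih]
    simp only [signSum_cons]
    rw [← Finset.expect_add_distrib]
    have h2 : ∀ τ : Fin m → ℤˣ,
        ((((1 : ℤˣ) : ℤ) : ℝ) * v 0 + signSum τ fun i => v i.succ) ^ 2
        + ((((-1 : ℤˣ) : ℤ) : ℝ) * v 0 + signSum τ fun i => v i.succ) ^ 2
        = 2 * v 0 ^ 2 + 2 * (signSum τ fun i => v i.succ) ^ 2 := by
      intro τ; push_cast; ring
    simp only [h2, Finset.expect_add_distrib, ← Finset.mul_expect]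
    simp
    ring

-- Odd powers of the new sign cancel. With `T` the sum of the remaining squares, the induction
-- closes by `v₀⁴ + 6v₀²T + 3T² ≤ 3(v₀² + T)²`.
open Finset in
lemma expect_signSum_pow_four_le : ∀ {m : ℕ} (v : Fin m → ℝ),
    expect univ (fun τ : Fin m → ℤˣ => signSum τ v ^ 4) ≤ 3 * (∑ y, v y ^ 2) ^ 2
  | 0, v => by simp [signSum]
  | m + 1, v => by
    have ih := expect_signSum_pow_four_le fun i : Fin m => v i.succ
    have hs := expect_signSum_sq fun i : Fin m => v i.succ
    rw [expect_fin_cons, expect_sign, Fin.sum_univ_succ]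
    simp only [signSum_cons]
    rw [← Finset.expect_add_distrib]
    have h2 : ∀ τ : Fin m → ℤˣ,
        ((((1 : ℤˣ) : ℤ) : ℝ) * v 0 + signSum τ fun i => v i.succ) ^ 4
        + ((((-1 : ℤˣ) : ℤ) : ℝ) * v 0 + signSum τ fun i => v i.succ) ^ 4
        = 2 * v 0 ^ 4 + (12 * v 0 ^ 2) * (signSum τ fun i => v i.succ) ^ 2
          + 2 * (signSum τ fun i => v i.succ) ^ 4 := by
      intro τ; push_cast; ring
    simp only [h2, Finset.expect_add_distrib, ← Finset.mul_expect, hs]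
    simp only [Finset.expect_const Finset.univ_nonempty]
    nlinarith [sq_nonneg (v 0 ^ 2)]

open Finset in
/-- **Khintchine's inequality** with a non-optimal constant. -/
lemma sqrt_sum_sq_le_expect_abs {m : ℕ} (v : Fin m → ℝ) :
    √(∑ y, v y ^ 2) ≤ 2 * expect univ (fun τ : Fin m → ℤˣ => |signSum τ v|) := by
  set s := √(∑ y, v y ^ 2) with hs
  have hs0 : 0 ≤ s := Real.sqrt_nonneg _
  have hss : s ^ 2 = ∑ y, v y ^ 2 := Real.sq_sqrt (Finset.sum_nonneg fun _ _ => sq_nonneg _)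
  have hE0 : 0 ≤ expect univ (fun τ : Fin m → ℤˣ => |signSum τ v|) :=
    Finset.expect_nonneg fun _ _ => abs_nonneg _
  rcases hs0.eq_or_lt with h0 | hpos
  · rw [← h0]; positivity
  have key : expect univ (fun τ : Fin m → ℤˣ =>
        s ^ 2 * signSum τ v ^ 2 - 4 / 27 * signSum τ v ^ 4)
      ≤ expect univ (fun τ : Fin m → ℤˣ => s ^ 3 * |signSum τ v|) := by
    refine Finset.expect_le_expect fun τ _ => ?_
    have hy : 0 ≤ |signSum τ v| := abs_nonneg _
    rw [← sq_abs (signSum τ v), ← Even.pow_abs (show Even 4 by decide) (signSum τ v)]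
    generalize |signSum τ v| = y at hy
    -- This product expands to `s³y - s²y² + (4/27)y⁴`; the constant `4/27` is what produces the
    -- double root at `y = 3s/2`.
    have : 0 ≤ y * ((s - 2 * y / 3) ^ 2 * (s + y / 3)) := by positivity
    nlinarith
  rw [Finset.expect_sub_distrib, ← Finset.mul_expect, ← Finset.mul_expect, ← Finset.mul_expect,
    expect_signSum_sq, ← hss] at key
  have h4 := expect_signSum_pow_four_le v
  rw [← hss] at h4
  -- The fourth moment is at most `3s⁴`, so the left side of `key` is at least `(1 - 12/27)s⁴ =
  -- (5/9)s⁴`, which exceeds `s⁴/2`.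
  have : s ^ 3 * s ≤ s ^ 3 * (2 * expect univ (fun τ : Fin m → ℤˣ => |signSum τ v|)) := by
    nlinarith [pow_pos hpos 4]
  exact le_of_mul_le_mul_left this (by positivity)

lemma le_iSup_fin {α : Type*} [Finite α] (A : α → ℝ) (a : α) : A a ≤ ⨆ a, A a :=
  le_ciSup (Set.finite_range A).bddAbove a

-- One step of the contraction: a single scalar sign is traded for `k` independent signs. The two
-- suprema are attained at some `a` and `b`; the Lipschitz condition and Khintchine's inequality
-- replace `h a - h b` by the mean of `2c|signSum τ (v a - v b)|`.
open Finset in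
lemma half_iSup_add_le {α : Type*} [Finite α] [Nonempty α] {k : ℕ} (A h : α → ℝ)
    (v : α → Fin k → ℝ) {c : ℝ} (hc : 0 ≤ c)
    (hLip : ∀ a b, h a - h b ≤ c * √(∑ y, (v a y - v b y) ^ 2)) :
    ((⨆ a, (A a + h a)) + ⨆ a, (A a - h a)) / 2
      ≤ expect univ fun τ : Fin k → ℤˣ => ⨆ a, (A a + 2 * c * signSum τ (v a)) := by
  obtain ⟨a, ha⟩ := exists_eq_ciSup_of_finite (f := fun a => A a + h a)
  obtain ⟨b, hb⟩ := exists_eq_ciSup_of_finite (f := fun a => A a - h a)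
  rw [← ha, ← hb]
  set M : (Fin k → ℤˣ) → ℝ := fun τ => ⨆ a, (A a + 2 * c * signSum τ (v a)) with hM
  have hM' : ∀ τ a, A a + 2 * c * signSum τ (v a) ≤ M τ := fun τ a =>
    le_iSup_fin (fun a => A a + 2 * c * signSum τ (v a)) a
  have h1 : ∀ τ : Fin k → ℤˣ,
      A a + A b + 2 * c * |signSum τ (fun y => v a y - v b y)| ≤ M τ + M (-τ) := by
    intro τ
    have e1 := hM' τ a
    have e2 := hM' τ b
    have e3 := hM' (-τ) a
    have e4 := hM' (-τ) b
    rw [signSum_neg] at e3 e4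
    rw [signSum_sub]
    -- According to the sign of the difference, `a` is evaluated at `τ` and `b` at `-τ`, or the
    -- other way round. Since `τ` and `-τ` have the same law, the mean of `M τ + M (-τ)` is twice
    -- that of `M`.
    rcases abs_cases (signSum τ (v a) - signSum τ (v b)) with ⟨e, _⟩ | ⟨e, _⟩ <;> rw [e] <;> linarith
  have h2 := Finset.expect_le_expect (s := (univ : Finset (Fin k → ℤˣ))) fun τ _ => h1 τ
  rw [Finset.expect_add_distrib, Finset.expect_add_distrib, Finset.expect_add_distrib,
    expect_neg_signs M, ← Finset.mul_expect, Finset.expect_const Finset.univ_nonempty,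
    Finset.expect_const Finset.univ_nonempty] at h2
  have h3 := mul_le_mul_of_nonneg_left (sqrt_sum_sq_le_expect_abs fun y => v a y - v b y) hc
  have h4 := hLip a b
  linarith

-- The arbitrary offset `A` makes the induction work: it absorbs the term of the first sign while
-- the others are treated, and then the terms already replaced while the first sign is treated.
open Finset in
lemma expect_iSup_signSum_le {α : Type*} [Finite α] [Nonempty α] {k : ℕ} {c : ℝ} (hc : 0 ≤ c) :
    ∀ {m : ℕ} (A : α → ℝ) (h : α → Fin m → ℝ) (v : α → Fin m → Fin k → ℝ),
    (∀ l a b, h a l - h b l ≤ c * √(∑ y, (v a l y - v b l y) ^ 2)) →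
    expect univ (fun σ : Fin m → ℤˣ => ⨆ a, (A a + signSum σ (h a)))
      ≤ expect univ fun τ : Fin m → Fin k → ℤˣ =>
          ⨆ a, (A a + 2 * c * ∑ l, signSum (τ l) (v a l))
  | 0, A, h, v, _ => by simp [signSum]
  | m + 1, A, h, v, hLip => by
    rw [expect_fin_cons, expect_fin_cons]
    simp only [signSum_cons, Fin.sum_univ_succ, Fin.cons_zero, Fin.cons_succ]
    calc
      _ ≤ expect univ fun s : ℤˣ => expect univ fun τ : Fin m → Fin k → ℤˣ =>
            ⨆ a, (A a + ((s : ℤ) : ℝ) * h a 0 + 2 * c * ∑ l, signSum (τ l) (v a l.succ)) := by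
          refine Finset.expect_le_expect fun s _ => ?_
          have := expect_iSup_signSum_le hc (fun a => A a + ((s : ℤ) : ℝ) * h a 0)
            (fun a l => h a l.succ) (fun a l => v a l.succ) fun l a b => hLip l.succ a b
          simpa only [add_assoc] using this
      _ = expect univ fun τ : Fin m → Fin k → ℤˣ => expect univ fun s : ℤˣ =>
            ⨆ a, (A a + ((s : ℤ) : ℝ) * h a 0 + 2 * c * ∑ l, signSum (τ l) (v a l.succ)) :=
          Finset.expect_comm _ _ _
      _ ≤ expect univ fun τ : Fin m → Fin k → ℤˣ => expect univ fun τ₀ : Fin k → ℤˣ =>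
            ⨆ a, (A a + 2 * c * (signSum τ₀ (v a 0) + ∑ l, signSum (τ l) (v a l.succ))) := by
          refine Finset.expect_le_expect fun τ _ => ?_
          have := half_iSup_add_le (fun a => A a + 2 * c * ∑ l, signSum (τ l) (v a l.succ))
            (fun a => h a 0) (fun a => v a 0) hc (hLip 0)
          rw [expect_sign]
          refine le_trans (le_of_eq ?_) (this.trans (le_of_eq ?_))
          · refine congrArg (· / 2) (congrArg₂ (· + ·) (congrArg iSup (funext fun a => ?_))
              (congrArg iSup (funext fun a => ?_))) <;> push_cast <;> ring
          · exact Finset.expect_congr rfl fun τ₀ _ => congrArg iSup (funext fun a => by ring)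
      _ = _ := Finset.expect_comm _ _ _

open Finset in
/-- **Vector contraction inequality** for Rademacher averages over a finite class. -/
lemma expect_iSup_signSum_contraction {α : Type*} [Finite α] [Nonempty α] {k m : ℕ} {c : ℝ}
    (hc : 0 ≤ c) (h : α → Fin m → ℝ) (v : α → Fin m → Fin k → ℝ)
    (hLip : ∀ l a b, h a l - h b l ≤ c * √(∑ y, (v a l y - v b l y) ^ 2)) :
    expect univ (fun σ : Fin m → ℤˣ => ⨆ a, signSum σ (h a))
      ≤ 2 * c * ∑ y, expect univ fun σ : Fin m → ℤˣ => ⨆ a, signSum σ (fun l => v a l y) := by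
  have h1 := expect_iSup_signSum_le hc (fun _ => 0) h v hLip
  simp only [zero_add] at h1
  refine h1.trans ?_
  -- Each column of a uniform `m × k` matrix of signs is itself a uniform vector of `m` signs.
  have h2 : ∀ y, (expect univ fun σ : Fin m → ℤˣ => ⨆ a, signSum σ (fun l => v a l y))
      = expect univ fun τ : Fin m → Fin k → ℤˣ =>
        ⨆ a, signSum (fun l => τ l y) (fun l => v a l y) := by
    intro y
    rw [← expect_comp_eval y fun σ : Fin m → ℤˣ => ⨆ a, signSum σ (fun l => v a l y)]
    exact Fintype.expect_equiv (Equiv.piComm fun _ _ => ℤˣ) _ _ fun τ => rfl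
  simp only [h2]
  rw [← Finset.expect_sum_comm, Finset.mul_expect]
  refine Finset.expect_le_expect fun τ _ => ciSup_le fun a => ?_
  refine mul_le_mul_of_nonneg_left ?_ (by positivity)
  simp only [signSum]
  rw [Finset.sum_comm]
  exact Finset.sum_le_sum fun y _ =>
    le_iSup_fin (fun a => ∑ l, (((τ l y : ℤˣ) : ℤ) : ℝ) * v a l y) a

end MCL

/-! ### Exponential moments and McDiarmid's inequality. -/

namespace MCL

lemma integrable_of_abs_le {Ω : Type*} [MeasurableSpace Ω] {μ : Measure Ω} [IsFiniteMeasure μ]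
    {f : Ω → ℝ} (hf : Measurable f) {B : ℝ} (hB : ∀ z, |f z| ≤ B) : Integrable f μ :=
  Integrable.of_bound hf.aestronglyMeasurable B (ae_of_all _ hB)

lemma abs_integral_le_of_abs_le {Ω : Type*} [MeasurableSpace Ω] {μ : Measure Ω}
    [IsProbabilityMeasure μ] {f : Ω → ℝ} {B : ℝ} (hB : ∀ z, |f z| ≤ B) : |∫ z, f z ∂μ| ≤ B := by
  have := norm_integral_le_of_norm_le_const (μ := μ) (f := f) (ae_of_all _ hB)
  simpa using this

/-- Hoeffding's lemma in terms of the oscillation: the values lie in the interval of length `c` that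
starts at the infimum. -/
lemma integral_exp_sub_integral_le {Ω : Type*} [MeasurableSpace Ω] (μ : Measure Ω)
    [IsProbabilityMeasure μ] {g : Ω → ℝ} (hg : Measurable g) {B c : ℝ} (hB : ∀ z, |g z| ≤ B)
    (hc : ∀ x x', g x - g x' ≤ c) :
    ∫ x, Real.exp (g x - ∫ x, g x ∂μ) ∂μ ≤ Real.exp (c ^ 2 / 8) := by
  have : Nonempty Ω := nonempty_of_isProbabilityMeasure μ
  have hbdd : BddBelow (Set.range g) := ⟨-B, by
    rintro _ ⟨x, rfl⟩
    exact (abs_le.1 (hB x)).1⟩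
  have hmem : ∀ x, g x ∈ Set.Icc (⨅ x, g x) ((⨅ x, g x) + c) := fun x => by
    refine ⟨ciInf_le hbdd x, ?_⟩
    have : g x - c ≤ ⨅ x, g x := le_ciInf fun x' => by linarith [hc x x']
    linarith
  have h := (ProbabilityTheory.hasSubgaussianMGF_of_mem_Icc (μ := μ) hg.aemeasurable
    (ae_of_all _ hmem)).mgf_le 1
  simp only [ProbabilityTheory.mgf, one_mul] at h
  refine h.trans (Real.exp_le_exp.2 (le_of_eq ?_))
  push_cast
  rw [add_sub_cancel_left, div_pow, Real.norm_eq_abs, sq_abs]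
  ring

lemma measurable_fin_cons {Ω : Type*} [MeasurableSpace Ω] {m : ℕ} :
    Measurable fun q : Ω × (Fin m → Ω) => (Fin.cons q.1 q.2 : Fin (m + 1) → Ω) := by
  refine measurable_pi_iff.2 fun i => ?_
  refine Fin.cases ?_ (fun j => ?_) i
  · simpa using measurable_fst
  · simpa [Function.comp_def] using (measurable_pi_apply j).comp measurable_snd

lemma integral_pi_fin_succ {Ω : Type*} [MeasurableSpace Ω] (μ : Measure Ω)
    [IsProbabilityMeasure μ] {m : ℕ} {f : (Fin (m + 1) → Ω) → ℝ} (hf : Measurable f) {B : ℝ}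
    (hB : ∀ z, |f z| ≤ B) :
    ∫ z, f z ∂(Measure.pi fun _ : Fin (m + 1) => μ)
      = ∫ x, ∫ z, f (Fin.cons x z : Fin (m + 1) → Ω) ∂(Measure.pi fun _ : Fin m => μ) ∂μ := by
  have h := (measurePreserving_piFinSuccAbove (fun _ : Fin (m + 1) => μ) 0).symm.integral_comp' f
  have hs : ∀ q : Ω × (Fin m → Ω), (MeasurableEquiv.piFinSuccAbove (fun _ : Fin (m + 1) => Ω) 0).symm q
      = (Fin.cons q.1 q.2 : Fin (m + 1) → Ω) := fun q => by
    simp [MeasurableEquiv.piFinSuccAbove_symm_apply, Fin.insertNthEquiv]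
  simp only [hs] at h
  rw [← h]
  exact integral_prod (μ := μ) (ν := Measure.pi fun _ : Fin m => μ)
    (fun q : Ω × (Fin m → Ω) => f (Fin.cons q.1 q.2 : Fin (m + 1) → Ω))
    (integrable_of_abs_le (hf.comp measurable_fin_cons) fun q => hB _)

/-- The exponential moment bound behind McDiarmid's inequality. -/
lemma integral_exp_sub_integral_le_of_bounded_differences {Ω : Type*} [MeasurableSpace Ω]
    (μ : Measure Ω) [IsProbabilityMeasure μ] {c : ℝ} : ∀ {m : ℕ} {f : (Fin m → Ω) → ℝ},
    Measurable f → ∀ {B : ℝ}, (∀ z, |f z| ≤ B) →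
    (∀ l z z', (∀ i, i ≠ l → z i = z' i) → f z - f z' ≤ c) →
    ∫ z, Real.exp (f z - ∫ z, f z ∂(Measure.pi fun _ : Fin m => μ))
      ∂(Measure.pi fun _ : Fin m => μ) ≤ Real.exp (m * (c ^ 2 / 8))
  | 0, f, hf, B, hB, hc => by
    have : ∀ z : Fin 0 → Ω, f z = f default := fun z => congrArg f (Subsingleton.elim _ _)
    simp [this]
  | m + 1, f, hf, B, hB, hc => by
    set P := Measure.pi fun _ : Fin m => μ with hP
    set g : Ω → ℝ := fun x => ∫ z, f (Fin.cons x z : Fin (m + 1) → Ω) ∂P with hg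
    have hfm : Measurable fun q : Ω × (Fin m → Ω) => f (Fin.cons q.1 q.2 : Fin (m + 1) → Ω) :=
      hf.comp measurable_fin_cons
    have hfx : ∀ x, Measurable fun z : Fin m → Ω => f (Fin.cons x z : Fin (m + 1) → Ω) := fun x =>
      hfm.comp measurable_prodMk_left
    have hgm : Measurable g := (hfm.stronglyMeasurable.integral_prod_right' (ν := P)).measurable
    have hgB : ∀ x, |g x| ≤ B := fun x => abs_integral_le_of_abs_le fun z => hB _
    have hint : ∀ x, Integrable (fun z : Fin m → Ω => f (Fin.cons x z : Fin (m + 1) → Ω)) P :=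
      fun x => integrable_of_abs_le (hfx x) fun z => hB _
    -- Averaging out the other coordinates preserves the bounded difference in the first, so
    -- Hoeffding's lemma applies to `g`; the fluctuation around `g` is left to the induction
    -- hypothesis.
    have hgc : ∀ x x', g x - g x' ≤ c := fun x x' => by
      simp only [hg]
      rw [← integral_sub (hint x) (hint x')]
      calc _ ≤ ∫ _, c ∂P := integral_mono ((hint x).sub (hint x')) (integrable_const _) fun z =>
            hc 0 _ _ fun i hi => by
              obtain ⟨j, rfl⟩ := Fin.exists_succ_eq.2 hi
              simp
        _ = c := by simp
    have hfE : ∫ z, f z ∂(Measure.pi fun _ : Fin (m + 1) => μ) = ∫ x, g x ∂μ :=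
      integral_pi_fin_succ μ hf hB
    have hEB : |∫ x, g x ∂μ| ≤ B := abs_integral_le_of_abs_le hgB
    have hexpB : ∀ z, |Real.exp (f z - ∫ x, g x ∂μ)| ≤ Real.exp (2 * B) := fun z => by
      rw [Real.abs_exp]
      exact Real.exp_le_exp.2 (by linarith [abs_le.1 (hB z), abs_le.1 hEB])
    rw [hfE, integral_pi_fin_succ μ (f := fun z => Real.exp (f z - ∫ x, g x ∂μ))
      (Real.measurable_exp.comp (hf.sub_const _)) hexpB]
    have hin : ∀ x, ∫ z, Real.exp (f (Fin.cons x z : Fin (m + 1) → Ω) - ∫ x, g x ∂μ) ∂P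
        ≤ Real.exp (m * (c ^ 2 / 8)) * Real.exp (g x - ∫ x, g x ∂μ) := fun x => by
      have ih := integral_exp_sub_integral_le_of_bounded_differences μ (hfx x)
        (fun z => hB (Fin.cons x z : Fin (m + 1) → Ω)) (fun l z z' h => hc l.succ _ _ fun i hi => by
          refine Fin.cases (by simp) (fun j hj => ?_) i hi
          simpa using h j fun e => hj (by rw [e]))
      have e : ∀ z : Fin m → Ω, Real.exp (f (Fin.cons x z : Fin (m + 1) → Ω) - ∫ x, g x ∂μ)
          = Real.exp (f (Fin.cons x z : Fin (m + 1) → Ω) - g x)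
            * Real.exp (g x - ∫ x, g x ∂μ) := fun z => by
        rw [← Real.exp_add]; ring_nf
      simp only [e]
      rw [integral_mul_const]
      exact mul_le_mul_of_nonneg_right ih (Real.exp_pos _).le
    have hlast := integral_exp_sub_integral_le μ hgm hgB hgc
    calc _ ≤ ∫ x, Real.exp (m * (c ^ 2 / 8)) * Real.exp (g x - ∫ x, g x ∂μ) ∂μ := by
          refine integral_mono_of_nonneg (ae_of_all _ fun x =>
            integral_nonneg fun z => (Real.exp_pos _).le) ?_ (ae_of_all _ hin)
          refine Integrable.const_mul (integrable_of_abs_le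
            (Real.measurable_exp.comp (hgm.sub_const _)) (B := Real.exp (2 * B)) fun x => ?_) _
          simp only [Function.comp]
          rw [Real.abs_exp]
          exact Real.exp_le_exp.2 (by linarith [abs_le.1 (hgB x), abs_le.1 hEB])
      _ ≤ Real.exp (m * (c ^ 2 / 8)) * Real.exp (c ^ 2 / 8) := by
          rw [integral_const_mul]
          exact mul_le_mul_of_nonneg_left hlast (Real.exp_pos _).le
      _ = _ := by rw [← Real.exp_add]; push_cast; ring_nf

/-- **McDiarmid's inequality** for a product of copies of one probability measure. -/
theorem measure_ge_le_of_bounded_differences {Ω : Type*} [MeasurableSpace Ω]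
    (μ : Measure Ω) [IsProbabilityMeasure μ] {c : ℝ} (hc0 : 0 < c) {m : ℕ} (hm : 0 < m)
    {f : (Fin m → Ω) → ℝ} (hf : Measurable f) {B : ℝ} (hB : ∀ z, |f z| ≤ B)
    (hc : ∀ l z z', (∀ i, i ≠ l → z i = z' i) → f z - f z' ≤ c) {t : ℝ} (ht : 0 ≤ t) :
    Measure.pi (fun _ : Fin m => μ)
        {z | (∫ z, f z ∂(Measure.pi fun _ : Fin m => μ)) + t ≤ f z}
      ≤ ENNReal.ofReal (Real.exp (-(2 * t ^ 2 / (m * c ^ 2)))) := by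
  set P := Measure.pi fun _ : Fin m => μ with hP
  have hm' : (0 : ℝ) < m := Nat.cast_pos.2 hm
  -- This is the minimizer of the Chernoff exponent `-rt + m r²c²/8`.
  set r : ℝ := 4 * t / (m * c ^ 2) with hr
  have hr0 : 0 ≤ r := by positivity
  have hmgf := integral_exp_sub_integral_le_of_bounded_differences μ (c := r * c)
    (f := fun z => r * f z) (hf.const_mul r) (B := r * B) (fun z => by
      rw [abs_mul, abs_of_nonneg hr0]
      exact mul_le_mul_of_nonneg_left (hB z) hr0) (fun l z z' h => by
      rw [← mul_sub]
      exact mul_le_mul_of_nonneg_left (hc l z z' h) hr0)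
  rw [integral_const_mul] at hmgf
  have hEB : |∫ z, f z ∂P| ≤ B := abs_integral_le_of_abs_le hB
  have hint : Integrable (fun z => Real.exp (r * (f z - ∫ z, f z ∂P))) P := by
    refine integrable_of_abs_le (Real.measurable_exp.comp ((hf.sub_const _).const_mul r))
      (B := Real.exp (r * (2 * B))) fun z => ?_
    rw [Real.abs_exp]
    exact Real.exp_le_exp.2 (mul_le_mul_of_nonneg_left
      (by linarith [abs_le.1 (hB z), abs_le.1 hEB]) hr0)
  have h := ProbabilityTheory.measure_ge_le_exp_mul_mgf (μ := P) (X := fun z => f z - ∫ z, f z ∂P)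
    t hr0 hint
  have hset : {z | (∫ z, f z ∂P) + t ≤ f z} = {z | t ≤ f z - ∫ z, f z ∂P} := by
    ext z
    simp only [Set.mem_ofPred_eq]
    constructor <;> intro h <;> linarith
  rw [hset, ← ENNReal.ofReal_toReal (measure_ne_top P _)]
  refine ENNReal.ofReal_le_ofReal (h.trans ?_)
  simp only [ProbabilityTheory.mgf, mul_sub]
  refine (mul_le_mul_of_nonneg_left hmgf (Real.exp_pos _).le).trans ?_
  rw [← Real.exp_add]
  refine Real.exp_le_exp.2 (le_of_eq ?_)
  rw [hr]
  field_simp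
  ring

/-! ### Symmetrization for finite classes. -/

lemma iSup_add_le_add_iSup {α : Type*} [Finite α] [Nonempty α] (u v : α → ℝ) :
    ⨆ a, (u a + v a) ≤ (⨆ a, u a) + ⨆ a, v a :=
  ciSup_le fun a => add_le_add (le_iSup_fin u a) (le_iSup_fin v a)

lemma abs_iSup_le {α : Type*} [Finite α] [Nonempty α] {u : α → ℝ} {B : ℝ} (h : ∀ a, |u a| ≤ B) :
    |⨆ a, u a| ≤ B := by
  obtain ⟨a, ha⟩ := exists_eq_ciSup_of_finite (f := u)
  rw [← ha]
  exact h a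

lemma abs_signSum_le {m : ℕ} (σ : Fin m → ℤˣ) {v : Fin m → ℝ} {B : ℝ} (h : ∀ l, |v l| ≤ B) :
    |signSum σ v| ≤ m * B := by
  refine (Finset.abs_sum_le_sum_abs _ _).trans ?_
  refine (Finset.sum_le_sum (g := fun _ => B) fun l _ => ?_).trans (by simp)
  rcases Int.units_eq_one_or (σ l) with e | e <;> simpa [e] using h l

/-- The empirical Rademacher average of the class `h` at the points `z`. -/
noncomputable def empRademacher {α Z : Type*} {m : ℕ} (h : α → Z → ℝ) (z : Fin m → Z) : ℝ :=
  Finset.expect Finset.univ fun σ : Fin m → ℤˣ => ⨆ a, signSum σ fun l => h a (z l)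

/-- Replacing the expectation by a ghost sample. -/
lemma integral_iSup_deviation_le_ghost {Z α : Type*} [MeasurableSpace Z] (μ : Measure Z)
    [IsProbabilityMeasure μ] [Finite α] [Nonempty α] {m : ℕ} {h : α → Z → ℝ}
    (hh : ∀ a, Measurable (h a)) {B : ℝ} (hB : ∀ a z, |h a z| ≤ B) :
    ∫ z, (⨆ a, ∑ l, ((∫ x, h a x ∂μ) - h a (z l))) ∂(Measure.pi fun _ : Fin m => μ)
      ≤ ∫ w, (⨆ a, ∑ l, (h a (w l).2 - h a (w l).1))
        ∂(Measure.pi fun _ : Fin m => μ.prod μ) := by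
  have hsumB : ∀ u : Fin m → ℝ, (∀ l, |u l| ≤ B + B) → |∑ l, u l| ≤ m * (B + B) := fun u hu =>
    (Finset.abs_sum_le_sum_abs _ _).trans ((Finset.sum_le_sum fun l _ => hu l).trans
      (by rw [Finset.sum_const, Finset.card_univ, Fintype.card_fin, nsmul_eq_mul]))
  have hdB : ∀ a x y, |h a x - h a y| ≤ B + B := fun a x y =>
    (abs_sub _ _).trans (add_le_add (hB _ _) (hB _ _))
  have hm2 : Measurable fun q : (Fin m → Z) × (Fin m → Z) =>
      ⨆ a, ∑ l, (h a (q.2 l) - h a (q.1 l)) := Measurable.iSup fun a => by fun_prop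
  have hm2B : ∀ z z' : Fin m → Z, |⨆ a, ∑ l, (h a (z' l) - h a (z l))| ≤ m * (B + B) :=
    fun z z' => abs_iSup_le fun a => hsumB _ fun l => hdB _ _ _
  have e := (measurePreserving_arrowProdEquivProdArrow Z Z (Fin m) (fun _ => μ)
    (fun _ => μ)).integral_comp' fun q : (Fin m → Z) × (Fin m → Z) =>
      ⨆ a, ∑ l, (h a (q.2 l) - h a (q.1 l))
  refine le_trans ?_ e.symm.le
  -- With the first sample fixed, each mean is an integral over the ghost sample, and the supremum
  -- of integrals is at most the integral of the supremum.
  rw [integral_prod _ (integrable_of_abs_le hm2 fun q => hm2B q.1 q.2)]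
  refine integral_mono ?_ ?_ fun z => ciSup_le fun a => ?_
  · refine integrable_of_abs_le (B := m * (B + B)) (Measurable.iSup fun a => by fun_prop) fun z =>
      abs_iSup_le fun a => hsumB _ fun l => ?_
    exact (abs_sub _ _).trans (add_le_add (abs_integral_le_of_abs_le (hB a)) (hB _ _))
  · exact integrable_of_abs_le (hm2.stronglyMeasurable.integral_prod_right').measurable fun z =>
      abs_integral_le_of_abs_le fun z' => hm2B z z'
  have hi : ∀ l, Integrable (fun z' : Fin m → Z => h a (z' l)) (Measure.pi fun _ : Fin m => μ) :=
    fun l => integrable_of_abs_le ((hh a).comp (measurable_pi_apply l)) fun z' => hB a _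
  have e1 : ∑ l, ((∫ x, h a x ∂μ) - h a (z l))
      = ∫ z' : Fin m → Z, ∑ l, (h a (z' l) - h a (z l)) ∂(Measure.pi fun _ : Fin m => μ) := by
    have e2 := integral_finsetSum (μ := Measure.pi fun _ : Fin m => μ) Finset.univ
      (f := fun l (z' : Fin m → Z) => h a (z' l) - h a (z l))
      fun l _ => (hi l).sub (integrable_const _)
    rw [e2]
    refine Finset.sum_congr rfl fun l _ => ?_
    rw [integral_sub (hi l) (integrable_const _)]
    have e3 : ∫ z' : Fin m → Z, h a (z' l) ∂(Measure.pi fun _ : Fin m => μ) = ∫ x, h a x ∂μ :=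
      integral_comp_eval (μ := fun _ : Fin m => μ) (i := l) (f := h a)
        (hh a).aestronglyMeasurable
    rw [e3]
    simp
  rw [e1]
  refine integral_mono ?_ (integrable_of_abs_le (hm2.comp measurable_prodMk_left) fun z' =>
    hm2B z z') fun z' => le_iSup_fin (fun a => ∑ l, (h a (z' l) - h a (z l))) a
  exact integrable_of_abs_le (by fun_prop) fun z' => hsumB _ fun l => hdB _ _ _

/-- Swapping the entries of a pair of independent samples according to signs. -/
lemma integral_iSup_signSum_swap {Z α : Type*} [MeasurableSpace Z] (μ : Measure Z)
    [IsProbabilityMeasure μ] [Finite α] [Nonempty α] {m : ℕ} {h : α → Z → ℝ}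
    (hh : ∀ a, Measurable (h a)) (σ : Fin m → ℤˣ) :
    ∫ w, (⨆ a, signSum σ fun l => h a (w l).2 - h a (w l).1)
        ∂(Measure.pi fun _ : Fin m => μ.prod μ)
      = ∫ w, (⨆ a, ∑ l, (h a (w l).2 - h a (w l).1))
        ∂(Measure.pi fun _ : Fin m => μ.prod μ) := by
  have hm : Measurable fun w : Fin m → Z × Z => ⨆ a, ∑ l, (h a (w l).2 - h a (w l).1) :=
    Measurable.iSup fun a => by fun_prop
  -- Exchanging the two entries at the indices of negative sign preserves the law and changes the
  -- sign of exactly those differences.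
  have hsw : MeasurePreserving
      (fun (w : Fin m → Z × Z) l => if σ l = 1 then w l else (w l).swap)
      (Measure.pi fun _ : Fin m => μ.prod μ) (Measure.pi fun _ : Fin m => μ.prod μ) := by
    refine measurePreserving_pi (f := fun l (q : Z × Z) => if σ l = 1 then q else q.swap) _ _ fun l => ?_
    by_cases hl : σ l = 1
    · simpa only [hl, if_true] using! MeasurePreserving.id (μ.prod μ)
    · simpa only [hl, if_false] using Measure.measurePreserving_swap
  have e := integral_map (μ := Measure.pi fun _ : Fin m => μ.prod μ) hsw.measurable.aemeasurable
    hm.aestronglyMeasurable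
  rw [hsw.map_eq] at e
  rw [e]
  refine integral_congr_ae (ae_of_all _ fun w => ?_)
  refine congrArg iSup (funext fun a => Finset.sum_congr rfl fun l _ => ?_)
  rcases Int.units_eq_one_or (σ l) with e | e <;> simp [e]

open Finset in
/-- **Symmetrization** for a finite class. -/
theorem integral_iSup_deviation_le {Z α : Type*} [MeasurableSpace Z] (μ : Measure Z)
    [IsProbabilityMeasure μ] [Finite α] [Nonempty α] {m : ℕ} {h : α → Z → ℝ}
    (hh : ∀ a, Measurable (h a)) {B : ℝ} (hB : ∀ a z, |h a z| ≤ B) :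
    ∫ z, (⨆ a, ∑ l, ((∫ x, h a x ∂μ) - h a (z l))) ∂(Measure.pi fun _ : Fin m => μ)
      ≤ 2 * ∫ z, empRademacher h z ∂(Measure.pi fun _ : Fin m => μ) := by
  have hTm : ∀ σ : Fin m → ℤˣ, Measurable fun z : Fin m → Z =>
      ⨆ a, signSum σ fun l => h a (z l) := fun σ => Measurable.iSup fun a => by
    unfold signSum
    fun_prop
  have hTi : ∀ σ : Fin m → ℤˣ, Integrable (fun z : Fin m → Z =>
      ⨆ a, signSum σ fun l => h a (z l)) (Measure.pi fun _ : Fin m => μ) := fun σ =>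
    integrable_of_abs_le (hTm σ) fun z => abs_iSup_le fun a => abs_signSum_le σ fun l => hB a _
  have pr1 : MeasurePreserving (fun (w : Fin m → Z × Z) l => (w l).1)
      (Measure.pi fun _ : Fin m => μ.prod μ) (Measure.pi fun _ : Fin m => μ) :=
    measurePreserving_pi _ _ fun _ => measurePreserving_fst
  have pr2 : MeasurePreserving (fun (w : Fin m → Z × Z) l => (w l).2)
      (Measure.pi fun _ : Fin m => μ.prod μ) (Measure.pi fun _ : Fin m => μ) :=
    measurePreserving_pi _ _ fun _ => measurePreserving_snd
  have hle : ∀ σ : Fin m → ℤˣ, ∫ w, (⨆ a, ∑ l, (h a (w l).2 - h a (w l).1))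
        ∂(Measure.pi fun _ : Fin m => μ.prod μ)
      ≤ ∫ z, (⨆ a, signSum σ fun l => h a (z l)) ∂(Measure.pi fun _ : Fin m => μ)
        + ∫ z, (⨆ a, signSum (-σ) fun l => h a (z l)) ∂(Measure.pi fun _ : Fin m => μ) := fun σ => by
    have e1 := integral_map (μ := Measure.pi fun _ : Fin m => μ.prod μ) pr1.measurable.aemeasurable
      (hTm (-σ)).aestronglyMeasurable
    have e2 := integral_map (μ := Measure.pi fun _ : Fin m => μ.prod μ) pr2.measurable.aemeasurable
      (hTm σ).aestronglyMeasurable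
    have i1 := pr1.integrable_comp_of_integrable (hTi (-σ))
    have i2 := pr2.integrable_comp_of_integrable (hTi σ)
    rw [pr1.map_eq] at e1
    rw [pr2.map_eq] at e2
    rw [← integral_iSup_signSum_swap μ hh σ, e1, e2]
    refine le_trans ?_ (integral_add i2 i1).le
    refine integral_mono ?_ (i2.add i1) fun w => ?_
    · refine integrable_of_abs_le (B := m * (B + B)) (Measurable.iSup fun a => ?_) fun w =>
        abs_iSup_le fun a => abs_signSum_le σ fun l =>
          (abs_sub _ _).trans (add_le_add (hB _ _) (hB _ _))
      unfold signSum
      fun_prop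
    refine le_trans (le_of_eq ?_) (iSup_add_le_add_iSup _ _)
    refine congrArg iSup (funext fun a => ?_)
    rw [signSum_sub, signSum_neg]
    ring
  have hE : ∫ z, empRademacher h z ∂(Measure.pi fun _ : Fin m => μ)
      = expect univ fun σ : Fin m → ℤˣ =>
        ∫ z, (⨆ a, signSum σ fun l => h a (z l)) ∂(Measure.pi fun _ : Fin m => μ) := by
    unfold empRademacher
    simp only [Fintype.expect_eq_sum_div_card]
    rw [integral_div, integral_finsetSum _ fun σ _ => hTi σ]
  -- On averaging over `σ`, the two integrals contribute equally because `-σ` is again uniform; this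
  -- is the factor `2`.
  have h4 := Finset.expect_le_expect (s := (univ : Finset (Fin m → ℤˣ))) fun σ _ => hle σ
  rw [Finset.expect_add_distrib, expect_neg_signs fun σ : Fin m → ℤˣ =>
    ∫ z, (⨆ a, signSum σ fun l => h a (z l)) ∂(Measure.pi fun _ : Fin m => μ),
    Finset.expect_const Finset.univ_nonempty] at h4
  have h5 := integral_iSup_deviation_le_ghost (m := m) μ hh hB
  rw [hE]
  linarith

end MCL

/-! ### Counting label sets; unbiasedness, range and Lipschitz constant of the complementary loss.
-/

namespace MCL

lemma sum_card_filter_sum_compl {M : Type*} [AddCommMonoid M] {k : ℕ} (j : ℕ)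
    (F : Finset (Fin k) → Fin k → M) :
    ∑ Y ∈ (Finset.univ : Finset (Finset (Fin k))).filter (fun Y => Y.card = j), ∑ y ∈ Yᶜ, F Y y
      = ∑ y, ∑ Y ∈ Finset.powersetCard j (Finset.univ.erase y), F Y y := by
  refine Finset.sum_comm' fun Y y => ?_
  simp only [Finset.mem_filter, Finset.mem_univ, true_and, Finset.mem_compl,
    Finset.mem_powersetCard, and_true]
  constructor
  · rintro ⟨h1, h2⟩
    exact ⟨fun a ha => Finset.mem_erase.2 ⟨fun e => h2 (e ▸ ha), Finset.mem_univ _⟩, h1⟩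
  · rintro ⟨h1, h2⟩
    exact ⟨h2, fun h => (Finset.mem_erase.1 (h1 h)).1 rfl⟩

/-- Double counting: a fixed element of `s` lies in as many of these subsets as there are
`j`-subsets of the rest of `s`. -/
lemma sum_powersetCard_sum {α : Type*} [DecidableEq α] (s : Finset α) (j : ℕ) (g : α → ℝ) :
    ∑ Y ∈ Finset.powersetCard (j + 1) s, ∑ y ∈ Y, g y
      = (Nat.choose (s.card - 1) j : ℝ) * ∑ y ∈ s, g y := by
  rw [Finset.mul_sum, Finset.sum_comm' (t' := s)
    (s' := fun y => (Finset.powersetCard (j + 1) s).filter fun Y => y ∈ Y)]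
  · refine Finset.sum_congr rfl fun y hy => ?_
    rw [Finset.sum_const, nsmul_eq_mul]
    congr 2
    rw [← Finset.card_erase_of_mem hy, ← Finset.card_powersetCard]
    refine Finset.card_bij' (fun Y _ => Y.erase y) (fun Y _ => insert y Y) ?_ ?_ ?_ ?_
    · intro Y hY
      simp only [Finset.mem_filter, Finset.mem_powersetCard] at hY ⊢
      exact ⟨Finset.erase_subset_erase _ hY.1.1, by rw [Finset.card_erase_of_mem hY.2, hY.1.2]; rfl⟩
    · intro Y hY
      simp only [Finset.mem_filter, Finset.mem_powersetCard] at hY ⊢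
      have : y ∉ Y := fun h => (Finset.mem_erase.1 (hY.1 h)).1 rfl
      exact ⟨⟨Finset.insert_subset hy (hY.1.trans (Finset.erase_subset _ _)), by
        rw [Finset.card_insert_of_notMem this, hY.2]⟩, Finset.mem_insert_self _ _⟩
    · intro Y hY
      exact Finset.insert_erase (Finset.mem_filter.1 hY).2
    · intro Y hY
      refine Finset.erase_insert fun h => ?_
      exact (Finset.mem_erase.1 ((Finset.mem_powersetCard.1 hY).1 h)).1 rfl
  · intro Y y
    simp only [Finset.mem_filter, Finset.mem_powersetCard]
    constructor
    · rintro ⟨h1, h2⟩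
      exact ⟨⟨h1, h2⟩, h1.1 h2⟩
    · rintro ⟨⟨h1, h2⟩, -⟩
      exact ⟨h1, h2⟩

/-- Averaging the complementary loss over the label sets of size `j` that avoid `y` gives the
ordinary loss at `y`. -/
lemma sum_powersetCard_compLoss {k j : ℕ} (hj : j ∈ Finset.Icc 1 (k - 1)) (g : Fin k → ℝ)
    (y : Fin k) :
    ∑ Y ∈ Finset.powersetCard j (Finset.univ.erase y),
        (∑ a ∈ Yᶜ, g a - (((k : ℝ) - 1 - (j : ℝ)) / (j : ℝ)) * ∑ a ∈ Y, g a)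
      = (Nat.choose (k - 1) j : ℝ) * g y := by
  obtain ⟨hj1, hjk⟩ := Finset.mem_Icc.1 hj
  have hj0 : (j : ℝ) ≠ 0 := by positivity
  have hc : ∀ Y : Finset (Fin k), ∑ a ∈ Yᶜ, g a = ∑ a, g a - ∑ a ∈ Y, g a := fun Y => by
    rw [eq_sub_iff_add_eq, Finset.sum_compl_add_sum]
  have hs : ∑ a ∈ Finset.univ.erase y, g a = ∑ a, g a - g y := by
    rw [eq_sub_iff_add_eq, Finset.sum_erase_add _ _ (Finset.mem_univ y)]
  have hcard : (Finset.univ.erase y).card = k - 1 := by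
    rw [Finset.card_erase_of_mem (Finset.mem_univ y), Finset.card_univ, Fintype.card_fin]
  have h1 := sum_powersetCard_sum (Finset.univ.erase y) (j - 1) g
  rw [Nat.sub_add_cancel hj1, hcard, hs] at h1
  simp only [hc]
  rw [Finset.sum_sub_distrib, Finset.sum_sub_distrib, ← Finset.mul_sum, h1, Finset.sum_const,
    Finset.card_powersetCard, hcard, nsmul_eq_mul]
  -- The absorption identity for binomial coefficients; it is what makes the weight `(k - 1 - j)/j`
  -- cancel every label other than `y`.
  have hch : ((k - 1).choose j : ℝ) * j = ((k : ℝ) - 1) * ((k - 1 - 1).choose (j - 1) : ℝ) := by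
    have h := Nat.add_one_mul_choose_eq (k - 1 - 1) (j - 1)
    have e1 : k - 1 - 1 + 1 = k - 1 := by omega
    have e2 : j - 1 + 1 = j := by omega
    rw [e1, e2] at h
    have h' : ((k - 1 : ℕ) : ℝ) * ((k - 1 - 1).choose (j - 1) : ℝ) = ((k - 1).choose j : ℝ) * j := by
      exact_mod_cast h
    rw [← h', Nat.cast_sub (by omega)]
    simp
  field_simp
  linear_combination ((∑ a, g a) - g y) * hch

lemma sum_restrict_label {X : Type*} [MeasurableSpace X] {k : ℕ} (D : Measure (X × Fin k)) :
    ∑ y : Fin k, D.restrict (Prod.snd ⁻¹' {y}) = D := by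
  ext s hs
  rw [Measure.finsetSum_apply]
  have hm : ∀ y : Fin k, MeasurableSet (Prod.snd ⁻¹' {y} : Set (X × Fin k)) := fun y =>
    measurable_snd (measurableSet_singleton y)
  simp only [Measure.restrict_apply hs]
  rw [← measure_biUnion_finset]
  · congr 1
    ext z
    simp
  · intro a _ b _ hab
    refine Set.disjoint_left.2 fun z hz hz' => hab ?_
    exact hz.2.symm.trans hz'.2
  · exact fun y _ => hs.inter (hm y)

lemma choose_ne_zero_of_mem {k j : ℕ} (hj : j ∈ Finset.Icc 1 (k - 1)) : (k - 1).choose j ≠ 0 :=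
  (Nat.choose_pos (Finset.mem_Icc.1 hj).2).ne'

lemma measurable_pair_labelSet {X : Type*} [MeasurableSpace X] {k : ℕ} (Y : Finset (Fin k)) :
    Measurable fun z : X × Fin k => ((z.1, Y) : Example X k) :=
  measurable_fst.prodMk measurable_const

/-- The instances of complementarily labelled examples have the original distribution. -/
lemma condLaw_map_fst {X : Type*} [MeasurableSpace X] {k j : ℕ} (D : Measure (X × Fin k))
    (hj : j ∈ Finset.Icc 1 (k - 1)) : (condLaw D j).map Prod.fst = D.fst := by
  ext s hs
  have hpre : MeasurableSet (Prod.fst ⁻¹' s : Set (Example X k)) := measurable_fst hs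
  rw [Measure.map_apply measurable_fst hs, Measure.fst_apply hs, condLaw, Measure.smul_apply,
    Measure.finsetSum_apply]
  simp only [Measure.finsetSum_apply, Measure.map_apply (measurable_pair_labelSet _) hpre]
  have e : ∀ Y : Finset (Fin k), (fun z : X × Fin k => ((z.1, Y) : Example X k)) ⁻¹'
      (Prod.fst ⁻¹' s) = Prod.fst ⁻¹' s := fun Y => rfl
  simp only [e]
  rw [sum_card_filter_sum_compl j fun _ y => D.restrict (Prod.snd ⁻¹' {y}) (Prod.fst ⁻¹' s)]
  simp only [Finset.sum_const, Finset.card_powersetCard, Finset.card_erase_of_mem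
    (Finset.mem_univ _), Finset.card_univ, Fintype.card_fin, nsmul_eq_mul]
  rw [← Finset.mul_sum, smul_eq_mul, ← mul_assoc, ENNReal.inv_mul_cancel
    (by exact_mod_cast choose_ne_zero_of_mem hj) (ENNReal.natCast_ne_top _), one_mul,
    ← Measure.finsetSum_apply, sum_restrict_label]

lemma isProbabilityMeasure_condLaw {X : Type*} [MeasurableSpace X] {k j : ℕ}
    (D : Measure (X × Fin k)) [IsProbabilityMeasure D] (hj : j ∈ Finset.Icc 1 (k - 1)) :
    IsProbabilityMeasure (condLaw D j) := by
  refine ⟨?_⟩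
  have h := congrArg (fun μ => μ Set.univ) (condLaw_map_fst D hj)
  simp only [Measure.map_apply measurable_fst MeasurableSet.univ, Set.preimage_univ] at h
  rw [h]
  exact measure_univ

lemma condLaw_card_ne {X : Type*} [MeasurableSpace X] {k j : ℕ} (D : Measure (X × Fin k)) :
    condLaw D j {z | z.2.card ≠ j} = 0 := by
  have hm : MeasurableSet {z : Example X k | z.2.card ≠ j} :=
    measurable_snd (MeasurableSpace.measurableSet_top (s := {Y : Finset (Fin k) | Y.card ≠ j}))
  have h0 : ∑ Y ∈ (Finset.univ : Finset (Finset (Fin k))).filter (fun Y => Y.card = j),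
      ∑ y ∈ Yᶜ, (D.restrict (Prod.snd ⁻¹' {y})).map (fun z => (z.1, Y))
        {z : Example X k | z.2.card ≠ j} = 0 := by
    refine Finset.sum_eq_zero fun Y hY => Finset.sum_eq_zero fun y _ => ?_
    rw [Measure.map_apply (measurable_pair_labelSet _) hm]
    have : (fun z : X × Fin k => ((z.1, Y) : Example X k)) ⁻¹' {z | z.2.card ≠ j} = ∅ := by
      ext z
      simp [(Finset.mem_filter.1 hY).2]
    rw [this, measure_empty]
  rw [condLaw, Measure.smul_apply, Measure.finsetSum_apply]
  simp only [Measure.finsetSum_apply]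
  rw [h0, smul_zero]

/-- The complementary loss of `f` at an example whose label set has size `j`; zero on the other
examples, which have probability zero under `condLaw D j`. -/
noncomputable def sizedLoss {X : Type*} {k : ℕ} (L : EuclideanSpace ℝ (Fin k) → Fin k → ℝ) (j : ℕ)
    (f : X → EuclideanSpace ℝ (Fin k)) (z : Example X k) : ℝ :=
  if z.2.card = j then compLoss L (f z.1) z.2 else 0

section Loss

variable {X : Type*} {k : ℕ} {L : EuclideanSpace ℝ (Fin k) → Fin k → ℝ}
  {ρ : ℝ≥0} {f : X → EuclideanSpace ℝ (Fin k)}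

/-- The positive part has `k - j` terms; the negative part has `j` terms of weight `(k - 1 - j)/j`.
The interval has length `(2k - 2j - 1)C`, which is the source of `devConst`. -/
lemma compLoss_mem_Icc {C : ℝ} {v : EuclideanSpace ℝ (Fin k)} (h0 : ∀ y, 0 ≤ L v y)
    (hC : ∀ y, L v y ≤ C) {Y : Finset (Fin k)} (hY : Y.card ∈ Finset.Icc 1 (k - 1)) :
    compLoss L v Y ∈ Set.Icc (-(((k : ℝ) - 1 - Y.card) * C)) (((k : ℝ) - Y.card) * C) := by
  obtain ⟨h1, h2⟩ := Finset.mem_Icc.1 hY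
  have hk : ((Yᶜ.card : ℕ) : ℝ) = (k : ℝ) - Y.card := by
    rw [Finset.card_compl, Fintype.card_fin, Nat.cast_sub (by omega)]
  have hk1 : (Y.card : ℝ) ≤ (k : ℝ) - 1 := by
    have : Y.card + 1 ≤ k := by omega
    have : ((Y.card + 1 : ℕ) : ℝ) ≤ k := by exact_mod_cast this
    push_cast at this
    linarith
  have hc0 : (0 : ℝ) < Y.card := by exact_mod_cast h1
  have a1 : ∑ y ∈ Yᶜ, L v y ≤ ((k : ℝ) - Y.card) * C := by
    rw [← hk, ← nsmul_eq_mul]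
    exact Finset.sum_le_card_nsmul _ _ _ fun y _ => hC y
  have a2 : ∑ y ∈ Y, L v y ≤ (Y.card : ℝ) * C := by
    rw [← nsmul_eq_mul]
    exact Finset.sum_le_card_nsmul _ _ _ fun y _ => hC y
  have b1 : 0 ≤ ∑ y ∈ Yᶜ, L v y := Finset.sum_nonneg fun y _ => h0 y
  have b2 : 0 ≤ ∑ y ∈ Y, L v y := Finset.sum_nonneg fun y _ => h0 y
  have hq : 0 ≤ ((k : ℝ) - 1 - Y.card) / Y.card := div_nonneg (by linarith) hc0.le
  have c1 := mul_le_mul_of_nonneg_left a2 hq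
  have c2 := mul_nonneg hq b2
  rw [← mul_assoc, div_mul_cancel₀ _ hc0.ne'] at c1
  unfold compLoss
  constructor <;> linarith

/-- The absolute values of the weights add up to `(k - j) + (k - 1 - j)`. -/
lemma compLoss_sub_le (hL : ∀ y, LipschitzWith ρ (fun v => L v y))
    (u v : EuclideanSpace ℝ (Fin k)) {Y : Finset (Fin k)} (hY : Y.card ∈ Finset.Icc 1 (k - 1)) :
    compLoss L u Y - compLoss L v Y ≤ (2 * (k : ℝ) - 2 * Y.card - 1) * ρ * dist u v := by
  obtain ⟨h1, h2⟩ := Finset.mem_Icc.1 hY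
  have hk : ((Yᶜ.card : ℕ) : ℝ) = (k : ℝ) - Y.card := by
    rw [Finset.card_compl, Fintype.card_fin, Nat.cast_sub (by omega)]
  have hk1 : (Y.card : ℝ) ≤ (k : ℝ) - 1 := by
    have : Y.card + 1 ≤ k := by omega
    have : ((Y.card + 1 : ℕ) : ℝ) ≤ k := by exact_mod_cast this
    push_cast at this
    linarith
  have hc0 : (0 : ℝ) < Y.card := by exact_mod_cast h1
  have hq : 0 ≤ ((k : ℝ) - 1 - Y.card) / Y.card := div_nonneg (by linarith) hc0.le
  have hd : ∀ y, |L u y - L v y| ≤ ρ * dist u v := fun y => (hL y).dist_le_mul u v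
  have a1 : ∑ y ∈ Yᶜ, (L u y - L v y) ≤ ((k : ℝ) - Y.card) * (ρ * dist u v) := by
    rw [← hk, ← nsmul_eq_mul]
    exact Finset.sum_le_card_nsmul _ _ _ fun y _ => (le_abs_self _).trans (hd y)
  have a2 : ∑ y ∈ Y, (L v y - L u y) ≤ (Y.card : ℝ) * (ρ * dist u v) := by
    rw [← nsmul_eq_mul]
    exact Finset.sum_le_card_nsmul _ _ _ fun y _ => by linarith [neg_abs_le (L u y - L v y), hd y]
  have c1 := mul_le_mul_of_nonneg_left a2 hq
  rw [← mul_assoc, div_mul_cancel₀ _ hc0.ne'] at c1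
  rw [Finset.sum_sub_distrib] at a1 c1
  unfold compLoss
  linarith

lemma abs_sizedLoss_le {C : ℝ} (h0 : ∀ x y, 0 ≤ L (f x) y) (hC : ∀ x y, L (f x) y ≤ C)
    (hC0 : 0 ≤ C) {j : ℕ} (hj : j ∈ Finset.Icc 1 (k - 1)) (z : Example X k) :
    |sizedLoss L j f z| ≤ k * C := by
  unfold sizedLoss
  split_ifs with h
  · subst h
    obtain ⟨h1, h2⟩ := compLoss_mem_Icc (h0 z.1) (hC z.1) hj
    have : (0 : ℝ) ≤ z.2.card := Nat.cast_nonneg _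
    exact abs_le.2 ⟨by nlinarith, by nlinarith⟩
  · simp only [abs_zero]
    positivity

variable [MeasurableSpace X]

lemma measurable_loss (hL : ∀ y, LipschitzWith ρ (fun v => L v y)) (hf : Measurable f)
    (y : Fin k) : Measurable fun x => L (f x) y :=
  (hL y).continuous.measurable.comp hf

lemma measurable_sizedLoss (hL : ∀ y, LipschitzWith ρ (fun v => L v y)) (hf : Measurable f)
    (j : ℕ) : Measurable (sizedLoss L j f : Example X k → ℝ) := by
  refine measurable_from_prod_countable_left fun Y => ?_
  by_cases h : Y.card = j
  · simp only [sizedLoss, h, if_true, compLoss]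
    have := fun y => measurable_loss hL hf y
    exact (Finset.measurable_sum _ fun y _ => this y).sub
      ((Finset.measurable_sum _ fun y _ => this y).const_mul _)
  · simp only [sizedLoss, h, if_false]
    exact measurable_const

lemma integral_condLaw (D : Measure (X × Fin k)) [IsProbabilityMeasure D] {j : ℕ}
    {g : Example X k → ℝ} (hg : Measurable g) {B : ℝ} (hB : ∀ z, |g z| ≤ B) :
    ∫ z, g z ∂(condLaw D j) = ((k - 1).choose j : ℝ)⁻¹ *
      ∑ y, ∑ Y ∈ Finset.powersetCard j (Finset.univ.erase y),
        ∫ z in Prod.snd ⁻¹' {y}, g (z.1, Y) ∂D := by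
  have hi : ∀ Y y, Integrable g
      ((D.restrict (Prod.snd ⁻¹' {y})).map (fun z => ((z.1, Y) : Example X k))) := fun Y y =>
    integrable_of_abs_le hg hB
  rw [condLaw, integral_smul_measure, integral_finsetSum_measure fun Y _ =>
    integrable_finsetSum_measure.2 fun y _ => hi Y y]
  simp only [integral_finsetSum_measure fun y _ => hi _ y]
  have e : ∀ Y y, ∫ z, g z ∂((D.restrict (Prod.snd ⁻¹' {y})).map
      (fun z => ((z.1, Y) : Example X k))) = ∫ z in Prod.snd ⁻¹' {y}, g (z.1, Y) ∂D := fun Y y =>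
    integral_map (measurable_pair_labelSet Y).aemeasurable hg.aestronglyMeasurable
  simp only [e]
  rw [sum_card_filter_sum_compl j fun Y y => ∫ z in Prod.snd ⁻¹' {y}, g (z.1, Y) ∂D]
  simp

/-- The complementary loss is an unbiased estimate of the risk. -/
lemma integral_sizedLoss (D : Measure (X × Fin k)) [IsProbabilityMeasure D]
    (hL : ∀ y, LipschitzWith ρ (fun v => L v y)) (hf : Measurable f) {C : ℝ}
    (h0 : ∀ x y, 0 ≤ L (f x) y) (hC : ∀ x y, L (f x) y ≤ C) (hC0 : 0 ≤ C) {j : ℕ}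
    (hj : j ∈ Finset.Icc 1 (k - 1)) :
    ∫ z, sizedLoss L j f z ∂(condLaw D j) = risk L D f := by
  have hLB : ∀ x y, |L (f x) y| ≤ C := fun x y => by rw [abs_of_nonneg (h0 x y)]; exact hC x y
  have hLi : ∀ (ν : Measure (X × Fin k)) [IsFiniteMeasure ν] (a : Fin k),
      Integrable (fun z : X × Fin k => L (f z.1) a) ν := fun ν _ a =>
    integrable_of_abs_le ((measurable_loss hL hf a).comp measurable_fst) fun z => hLB _ _
  have hch : ((k - 1).choose j : ℝ) ≠ 0 := by exact_mod_cast choose_ne_zero_of_mem hj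
  have hrisk : risk L D f = ∑ y, ∫ z in Prod.snd ⁻¹' {y}, L (f z.1) y ∂D := by
    have hmz : Measurable fun z : X × Fin k => L (f z.1) z.2 :=
      measurable_from_prod_countable_left fun y => measurable_loss hL hf y
    conv_lhs => rw [risk, ← sum_restrict_label D]
    rw [integral_finsetSum_measure fun y _ => integrable_of_abs_le hmz fun z => hLB _ _]
    refine Finset.sum_congr rfl fun y _ => ?_
    refine setIntegral_congr_fun (measurable_snd (measurableSet_singleton y)) fun z hz => ?_
    have hz' : z.2 = y := hz
    simp only [hz']
  rw [integral_condLaw D (measurable_sizedLoss hL hf j) (abs_sizedLoss_le h0 hC hC0 hj), hrisk,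
    inv_mul_eq_iff_eq_mul₀ hch, Finset.mul_sum]
  refine Finset.sum_congr rfl fun y _ => ?_
  rw [← sum_powersetCard_compLoss hj (fun a => ∫ z in Prod.snd ⁻¹' {y}, L (f z.1) a ∂D) y]
  refine Finset.sum_congr rfl fun Y hY => ?_
  have hcard := (Finset.mem_powersetCard.1 hY).2
  simp only [sizedLoss, hcard, if_true, compLoss]
  rw [integral_sub (integrable_finsetSum _ fun a _ => hLi _ a)
    ((integrable_finsetSum _ fun a _ => hLi _ a).const_mul _), integral_const_mul,
    integral_finsetSum _ fun a _ => hLi _ a, integral_finsetSum _ fun a _ => hLi _ a]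

end Loss

/-! ### Mixtures of product measures and subsamples. -/

/-- A product of mixtures is a mixture of products. -/
lemma pi_finsetSum_smul {Z : Type*} [MeasurableSpace Z] {n : ℕ} (J : Finset ℕ) (p : ℕ → ℝ≥0)
    (ν : ℕ → Measure Z) (hν : ∀ j ∈ J, IsFiniteMeasure (ν j)) :
    Measure.pi (fun _ : Fin n => ∑ j ∈ J, p j • ν j)
      = ∑ s ∈ Fintype.piFinset (fun _ : Fin n => J),
          (∏ i, p (s i)) • Measure.pi (fun i => ν (s i)) := by
  have hfin : IsFiniteMeasure (∑ j ∈ J, p j • ν j) := by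
    refine ⟨?_⟩
    rw [Measure.finsetSum_apply]
    refine ENNReal.sum_lt_top.2 fun j hj => ?_
    have := hν j hj
    exact measure_lt_top _ _
  refine Measure.pi_eq (fun t ht => ?_)
  rw [Measure.finsetSum_apply]
  simp only [Measure.finsetSum_apply]
  rw [Finset.prod_univ_sum]
  refine Finset.sum_congr rfl fun s hs => ?_
  have : ∀ i, IsFiniteMeasure (ν (s i)) := fun i => hν _ (Fintype.mem_piFinset.1 hs i)
  rw [Measure.smul_apply, Measure.pi_pi]
  simp only [Measure.smul_apply, ENNReal.smul_def, smul_eq_mul]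
  rw [Finset.prod_mul_distrib, ENNReal.ofNNReal_finsetProd]

/-- Distinct coordinates of a product measure are independent with the given marginals. It serves to
extract the examples of a given size. -/
lemma measurePreserving_pi_comp {Z : Type*} [MeasurableSpace Z] {n m : ℕ}
    (μ : Fin n → Measure Z) [∀ i, IsProbabilityMeasure (μ i)] {e : Fin m → Fin n}
    (he : Function.Injective e) :
    MeasurePreserving (fun (S : Fin n → Z) l => S (e l)) (Measure.pi μ)
      (Measure.pi fun l => μ (e l)) := by
  refine ⟨by fun_prop, ?_⟩
  have h := (ProbabilityTheory.iIndepFun_pi (μ := μ) (X := fun _ => id)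
    fun i => measurable_id.aemeasurable).precomp he
  have h2 := (ProbabilityTheory.iIndepFun_iff_map_fun_eq_pi_map
    (fun l => (measurable_pi_apply (e l)).aemeasurable)).1 h
  refine h2.trans ?_
  congr 1
  funext l
  exact (measurePreserving_eval μ (e l)).map_eq

end MCL

/-! ### Uniform deviations for finite classes and sequences. -/

namespace MCL

lemma empRademacher_nonneg {α Z : Type*} [Finite α] [Nonempty α] {m : ℕ} (h : α → Z → ℝ)
    (z : Fin m → Z) : 0 ≤ empRademacher h z := by
  obtain ⟨a⟩ := ‹Nonempty α›
  have := expect_signSum fun l => h a (z l)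
  rw [← this]
  exact Finset.expect_le_expect fun σ _ => le_iSup_fin (fun a => signSum σ fun l => h a (z l)) a

lemma measurable_empRademacher {α Z : Type*} [MeasurableSpace Z] [Finite α] {m : ℕ}
    {h : α → Z → ℝ} (hh : ∀ a, Measurable (h a)) :
    Measurable fun z : Fin m → Z => empRademacher h z := by
  unfold empRademacher
  simp only [Fintype.expect_eq_sum_div_card]
  refine (Finset.measurable_sum _ fun σ _ => Measurable.iSup fun a => ?_).div_const _
  unfold signSum
  fun_prop

lemma abs_empRademacher_le {α Z : Type*} [Finite α] [Nonempty α] {m : ℕ} {h : α → Z → ℝ} {B : ℝ}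
    (hB : ∀ a z, |h a z| ≤ B) (z : Fin m → Z) : |empRademacher h z| ≤ m * B := by
  rw [abs_of_nonneg (empRademacher_nonneg h z)]
  exact Finset.expect_le Finset.univ_nonempty fun σ _ =>
    (le_abs_self _).trans (abs_iSup_le fun a => abs_signSum_le σ fun l => hB a _)

lemma ereal_coe_sum {ι : Type*} (s : Finset ι) (f : ι → ℝ) :
    ((∑ i ∈ s, f i : ℝ) : EReal) = ∑ i ∈ s, (f i : EReal) := by
  induction s using Finset.cons_induction with
  | empty => simp
  | cons a s ha ih => rw [Finset.sum_cons, Finset.sum_cons, EReal.coe_add, ih]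

/-- The Rademacher average of a finite subclass is at most that of the class. -/
lemma empRademacher_le_signAverage {α Z : Type*} [Finite α] [Nonempty α] {m : ℕ}
    {g : α → Z → ℝ} {H : Set (Z → ℝ)} (hg : ∀ a, g a ∈ H) (z : Fin m → Z) :
    (((1 / (m : ℝ)) * empRademacher g z : ℝ) : EReal) ≤ signAverage H z := by
  have e : (1 / (m : ℝ)) * empRademacher g z
      = (∑ σ : Fin m → ℤˣ, (1 / (m : ℝ)) * ⨆ a, signSum σ fun l => g a (z l)) / 2 ^ m := by
    rw [empRademacher, Fintype.expect_eq_sum_div_card, ← Finset.mul_sum, mul_div_assoc]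
    simp
  rw [e, EReal.coe_div, ereal_coe_sum]
  have e2 : ((2 ^ m : ℝ) : EReal) = (2 : EReal) ^ m := by
    rw [EReal.coe_pow]
    rfl
  rw [e2, signAverage]
  refine EReal.div_le_div_right_of_nonneg
    (by rw [← e2]; exact EReal.coe_nonneg.2 (by positivity)) (Finset.sum_le_sum fun σ _ => ?_)
  obtain ⟨a, ha⟩ := exists_eq_ciSup_of_finite (f := fun a => signSum σ fun l => g a (z l))
  rw [← ha]
  exact le_iSup₂_of_le (g a) (hg a) le_rfl

lemma ofReal_empRademacher_le {α Z : Type*} [Finite α] [Nonempty α] {m : ℕ} (hm : 0 < m)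
    {g : α → Z → ℝ} {H : Set (Z → ℝ)} (hg : ∀ a, g a ∈ H) (z : Fin m → Z) :
    ENNReal.ofReal (empRademacher g z) ≤ m * (signAverage H z).toENNReal := by
  have h := EReal.toENNReal_le_toENNReal (empRademacher_le_signAverage hg z)
  rw [EReal.real_coe_toENNReal] at h
  have hm' : (0 : ℝ) < m := Nat.cast_pos.2 hm
  calc ENNReal.ofReal (empRademacher g z)
      = ENNReal.ofReal (m * ((1 / (m : ℝ)) * empRademacher g z)) := by
        congr 1
        field_simp
    _ = m * ENNReal.ofReal ((1 / (m : ℝ)) * empRademacher g z) := by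
        rw [ENNReal.ofReal_mul hm'.le, ENNReal.ofReal_natCast]
    _ ≤ _ := mul_le_mul_right h _

section Deviation

variable {X : Type*} {k : ℕ} {L : EuclideanSpace ℝ (Fin k) → Fin k → ℝ} {ρ : ℝ≥0}

/-- The excess complementary loss of `f` over `f₀`. -/
noncomputable def excess (L : EuclideanSpace ℝ (Fin k) → Fin k → ℝ) (j : ℕ)
    (f₀ f : X → EuclideanSpace ℝ (Fin k)) (z : Example X k) : ℝ :=
  sizedLoss L j f z - sizedLoss L j f₀ z

/-- Both losses lie in the same interval of length `(2k - 2j - 1)C`, so their difference costs one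
length and not two. -/
lemma abs_excess_le {C : ℝ} {f₀ f : X → EuclideanSpace ℝ (Fin k)} (hL0 : ∀ v y, 0 ≤ L v y)
    (hC0 : 0 ≤ C) (hf₀ : ∀ x y, L (f₀ x) y ≤ C) (hf : ∀ x y, L (f x) y ≤ C) {j : ℕ}
    (hj : j ∈ Finset.Icc 1 (k - 1)) (z : Example X k) :
    |excess L j f₀ f z| ≤ (2 * (k : ℝ) - 2 * j - 1) * C := by
  have hjk : (j : ℝ) + 1 ≤ k := by
    have := Finset.mem_Icc.1 hj
    exact_mod_cast (by omega : j + 1 ≤ k)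
  unfold excess sizedLoss
  split_ifs with h
  · subst h
    obtain ⟨h1, h2⟩ := compLoss_mem_Icc (hL0 _) (hf₀ z.1) hj
    obtain ⟨h3, h4⟩ := compLoss_mem_Icc (hL0 _) (hf z.1) hj
    exact abs_le.2 ⟨by linarith, by linarith⟩
  · rw [sub_zero, abs_zero]
    exact mul_nonneg (by linarith) hC0

lemma excess_sub_le (hL : ∀ y, LipschitzWith ρ (fun v => L v y)) {j : ℕ}
    (hj : j ∈ Finset.Icc 1 (k - 1)) (f₀ f g : X → EuclideanSpace ℝ (Fin k)) (z : Example X k) :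
    excess L j f₀ f z - excess L j f₀ g z
      ≤ (2 * (k : ℝ) - 2 * j - 1) * ρ * √(∑ y, (f z.1 y - g z.1 y) ^ 2) := by
  have hjk : (j : ℝ) + 1 ≤ k := by
    have := Finset.mem_Icc.1 hj
    exact_mod_cast (by omega : j + 1 ≤ k)
  unfold excess sizedLoss
  split_ifs with h
  · subst h
    have := compLoss_sub_le hL (f z.1) (g z.1) hj
    rw [EuclideanSpace.dist_eq] at this
    simp only [Real.dist_eq, sq_abs] at this
    linarith
  · rw [sub_self]
    have : (0 : ℝ) ≤ 2 * k - 2 * j - 1 := by linarith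
    positivity

variable [MeasurableSpace X]

/-- Symmetrization and contraction for the excess losses of finitely many functions. -/
lemma ofReal_integral_iSup_excess_le (D : Measure (X × Fin k)) [IsProbabilityMeasure D]
    {F : Set (X → EuclideanSpace ℝ (Fin k))} (hF : ∀ f ∈ F, Measurable f)
    (hL0 : ∀ v y, 0 ≤ L v y) (hL : ∀ y, LipschitzWith ρ (fun v => L v y)) {C : ℝ} (hC0 : 0 ≤ C)
    (hFC : ∀ f ∈ F, ∀ x y, L (f x) y ≤ C) {f₀ : X → EuclideanSpace ℝ (Fin k)} (hf₀ : f₀ ∈ F)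
    {α : Type*} [Finite α] [Nonempty α] {u : α → X → EuclideanSpace ℝ (Fin k)}
    (hu : ∀ a, u a ∈ F) {j : ℕ} (hj : j ∈ Finset.Icc 1 (k - 1)) {m : ℕ} (hm : 0 < m) :
    ENNReal.ofReal (∫ z, (⨆ a, ∑ l, ((∫ x, excess L j f₀ (u a) x ∂(condLaw D j))
        - excess L j f₀ (u a) (z l))) ∂(Measure.pi fun _ : Fin m => condLaw D j))
      ≤ ENNReal.ofReal (4 * ((2 * (k : ℝ) - 2 * j - 1) * ρ)) *
        (m * ∑ y, rademacher m D.fst (coordClass F y)) := by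
  have := isProbabilityMeasure_condLaw D hj
  have hjk : (j : ℝ) + 1 ≤ k := by
    have := Finset.mem_Icc.1 hj
    exact_mod_cast (by omega : j + 1 ≤ k)
  set c : ℝ := (2 * (k : ℝ) - 2 * j - 1) * ρ with hc
  have hc0 : 0 ≤ c := mul_nonneg (by linarith) ρ.2
  have hm1 : ∀ a, Measurable (excess L j f₀ (u a)) := fun a =>
    (measurable_sizedLoss hL (hF _ (hu a)) j).sub (measurable_sizedLoss hL (hF _ hf₀) j)
  have hB1 : ∀ a z, |excess L j f₀ (u a) z| ≤ (2 * (k : ℝ) - 2 * j - 1) * C := fun a z =>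
    abs_excess_le hL0 hC0 (hFC _ hf₀) (hFC _ (hu a)) hj z
  -- The subtracted loss of `f₀` does not depend on the index `a`, so it does not enter the
  -- Lipschitz constant.
  have hcontr : ∀ z : Fin m → Example X k, empRademacher (fun a => excess L j f₀ (u a)) z
      ≤ 2 * c * ∑ y, empRademacher (fun a x => u a x y) (fun l => (z l).1) := fun z =>
    expect_iSup_signSum_contraction hc0 (fun a l => excess L j f₀ (u a) (z l))
      (fun a l y => u a (z l).1 y) fun l a b => excess_sub_le hL hj f₀ (u a) (u b) (z l)
  have hmp : MeasurePreserving (fun (z : Fin m → Example X k) l => (z l).1)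
      (Measure.pi fun _ : Fin m => condLaw D j) (Measure.pi fun _ : Fin m => D.fst) :=
    measurePreserving_pi _ _ fun _ => ⟨measurable_fst, condLaw_map_fst D hj⟩
  have hmy : ∀ y, Measurable fun x : Fin m → X => empRademacher (fun a x => u a x y) x := fun y =>
    measurable_empRademacher fun a => by
      have := hF _ (hu a)
      fun_prop
  have hrad : ∀ y, ∫⁻ z : Fin m → Example X k,
        ENNReal.ofReal (empRademacher (fun a x => u a x y) (fun l => (z l).1))
          ∂(Measure.pi fun _ : Fin m => condLaw D j)
      ≤ m * rademacher m D.fst (coordClass F y) := fun y => by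
    rw [hmp.lintegral_comp (f := fun x : Fin m → X =>
      ENNReal.ofReal (empRademacher (fun a x => u a x y) x)) (hmy y).ennreal_ofReal, rademacher,
      ← lintegral_const_mul' _ _ (ENNReal.natCast_ne_top m)]
    exact lintegral_mono fun x => ofReal_empRademacher_le hm (g := fun a x => u a x y)
      (H := coordClass F y) (fun a => ⟨u a, hu a, rfl⟩) x
  have hint : Integrable (fun z : Fin m → Example X k =>
      empRademacher (fun a => excess L j f₀ (u a)) z)
      (Measure.pi fun _ : Fin m => condLaw D j) :=
    integrable_of_abs_le (measurable_empRademacher hm1) (abs_empRademacher_le hB1)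
  have hR : ENNReal.ofReal (∫ z, empRademacher (fun a => excess L j f₀ (u a)) z
        ∂(Measure.pi fun _ : Fin m => condLaw D j))
      ≤ ENNReal.ofReal (2 * c) * (m * ∑ y, rademacher m D.fst (coordClass F y)) := by
    rw [ofReal_integral_eq_lintegral_ofReal hint (ae_of_all _ fun z => empRademacher_nonneg _ z)]
    calc _ ≤ ∫⁻ z : Fin m → Example X k, ENNReal.ofReal (2 * c) *
          ∑ y, ENNReal.ofReal (empRademacher (fun a x => u a x y) (fun l => (z l).1))
            ∂(Measure.pi fun _ : Fin m => condLaw D j) := by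
          refine lintegral_mono fun z => ?_
          rw [← ENNReal.ofReal_sum_of_nonneg fun y _ => empRademacher_nonneg _ _,
            ← ENNReal.ofReal_mul (by positivity)]
          exact ENNReal.ofReal_le_ofReal (hcontr z)
      _ = ENNReal.ofReal (2 * c) * ∑ y, ∫⁻ z : Fin m → Example X k,
          ENNReal.ofReal (empRademacher (fun a x => u a x y) (fun l => (z l).1))
            ∂(Measure.pi fun _ : Fin m => condLaw D j) := by
          rw [lintegral_const_mul' _ _ ENNReal.ofReal_ne_top, lintegral_finsetSum]
          exact fun y _ => ((hmy y).comp hmp.measurable).ennreal_ofReal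
      _ ≤ _ := by
          rw [Finset.mul_sum (a := (m : ℝ≥0∞))]
          exact mul_le_mul_right (Finset.sum_le_sum fun y _ => hrad y) _
  refine (ENNReal.ofReal_le_ofReal (integral_iSup_deviation_le (m := m) (condLaw D j) hm1 hB1)).trans
    ?_
  rw [ENNReal.ofReal_mul (by norm_num)]
  refine (mul_le_mul_right hR _).trans (le_of_eq ?_)
  rw [← mul_assoc, ← ENNReal.ofReal_mul (by norm_num)]
  congr 2
  ring

/-- The deviation between the true and the empirical excess risk of `f` over `f₀`. -/
noncomputable def deviation (L : EuclideanSpace ℝ (Fin k) → Fin k → ℝ) (D : Measure (X × Fin k))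
    (j : ℕ) (f₀ f : X → EuclideanSpace ℝ (Fin k)) {m : ℕ} (z : Fin m → Example X k) : ℝ :=
  risk L D f - risk L D f₀ - (1 / (m : ℝ)) * ∑ l, excess L j f₀ f (z l)

/-- The contribution of the label sets of size `j` to the error bound, for `m` such sets. -/
noncomputable def sizeBound (D : Measure (X × Fin k)) (F : Set (X → EuclideanSpace ℝ (Fin k)))
    (ρ : ℝ≥0) (C δ : ℝ) (j m : ℕ) : ℝ≥0∞ :=
  ENNReal.ofReal (4 * √2 * (ρ : ℝ) * (k : ℝ) * ((k : ℝ) - 1) / (j : ℝ)) *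
      ∑ y : Fin k, rademacher m D.fst (coordClass F y)
    + ENNReal.ofReal (devConst k j C δ) / ENNReal.ofReal (√(m : ℝ))

/-- It suffices that `(2k - 2j - 1)j ≤ k(k - 1)`, which follows from `(k - 2j)² ≥ 0` and `k ≥ 2`;
only `√2 ≥ 1` is needed of the square root. -/
lemma contraction_const_le {j : ℕ} (hj : j ∈ Finset.Icc 1 (k - 1)) :
    4 * ((2 * (k : ℝ) - 2 * j - 1) * ρ) ≤ 4 * √2 * (ρ : ℝ) * (k : ℝ) * ((k : ℝ) - 1) / (j : ℝ) := by
  obtain ⟨h1, h2⟩ := Finset.mem_Icc.1 hj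
  have hj1 : (1 : ℝ) ≤ j := by exact_mod_cast h1
  have hjk : (j : ℝ) + 1 ≤ k := by exact_mod_cast (by omega : j + 1 ≤ k)
  have hs : 1 ≤ √(2 : ℝ) := Real.one_le_sqrt.2 (by norm_num)
  rw [le_div_iff₀ (by linarith)]
  have h3 : (2 * (k : ℝ) - 2 * j - 1) * j ≤ k * (k - 1) := by nlinarith [sq_nonneg ((k : ℝ) - 2 * j)]
  have hk0 : (0 : ℝ) ≤ k * (k - 1) := mul_nonneg (by linarith) (by linarith)
  have h4 : (k : ℝ) * (k - 1) ≤ √2 * (k * (k - 1)) := le_mul_of_one_le_left hk0 hs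
  have h5 := mul_le_mul_of_nonneg_left (h3.trans h4) (mul_nonneg (by norm_num : (0 : ℝ) ≤ 4) ρ.2)
  nlinarith [h5]

/-- `devConst` is `2(2k - 2j - 1)C` times the root of half the logarithm, and `2(2k - 2j - 1)C` is
the bounded difference of the unnormalized deviation. McDiarmid's exponent is therefore exactly the
logarithm. -/
lemma exp_neg_devConst {j m : ℕ} (hj : j ∈ Finset.Icc 1 (k - 1)) (hm : 0 < m) {C δ : ℝ}
    (hC : 0 < C) (hδ : 0 < δ) (hδ1 : δ < 1) :
    Real.exp (-(2 * (devConst k j C δ * √m) ^ 2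
        / (m * (2 * ((2 * (k : ℝ) - 2 * j - 1) * C)) ^ 2))) = δ / (2 * ((k : ℝ) - 1)) := by
  obtain ⟨h1, h2⟩ := Finset.mem_Icc.1 hj
  have hj1 : (1 : ℝ) ≤ j := by exact_mod_cast h1
  have hjk : (j : ℝ) + 1 ≤ k := by exact_mod_cast (by omega : j + 1 ≤ k)
  have hk1 : (0 : ℝ) < k - 1 := by linarith
  have hm' : (0 : ℝ) < m := Nat.cast_pos.2 hm
  have hpos : 0 < 2 * ((k : ℝ) - 1) / δ := by positivity
  have hlog : 0 ≤ Real.log (2 * ((k : ℝ) - 1) / δ) := by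
    refine Real.log_nonneg ?_
    rw [le_div_iff₀ hδ]
    linarith
  have hW : 0 < 2 * (k : ℝ) - 2 * j - 1 := by linarith
  have e : 2 * (devConst k j C δ * √m) ^ 2 / (m * (2 * ((2 * (k : ℝ) - 2 * j - 1) * C)) ^ 2)
      = Real.log (2 * ((k : ℝ) - 1) / δ) := by
    rw [devConst, mul_pow, mul_pow, Real.sq_sqrt (by positivity), Real.sq_sqrt hm'.le]
    have : (4 * (k : ℝ) - 4 * j - 2) = 2 * (2 * (k : ℝ) - 2 * j - 1) := by ring
    rw [this]
    generalize 2 * (k : ℝ) - 2 * j - 1 = w at hW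
    field_simp
  rw [e, Real.exp_neg, Real.exp_log hpos, inv_div]

lemma devConst_pos {j : ℕ} (hj : j ∈ Finset.Icc 1 (k - 1)) {C δ : ℝ}
    (hC : 0 < C) (hδ : 0 < δ) (hδ1 : δ < 1) : 0 < devConst k j C δ := by
  obtain ⟨h1, h2⟩ := Finset.mem_Icc.1 hj
  have hj1 : (1 : ℝ) ≤ j := by exact_mod_cast h1
  have hjk : (j : ℝ) + 1 ≤ k := by exact_mod_cast (by omega : j + 1 ≤ k)
  have hlog : 0 < Real.log (2 * ((k : ℝ) - 1) / δ) := by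
    refine Real.log_pos ?_
    rw [lt_div_iff₀ hδ]
    linarith
  have : 0 < 4 * (k : ℝ) - 4 * j - 2 := by linarith
  unfold devConst
  positivity

/-- Uniform deviation bound for a sequence of functions. -/
lemma measure_exists_deviation_le (D : Measure (X × Fin k)) [IsProbabilityMeasure D]
    {F : Set (X → EuclideanSpace ℝ (Fin k))} (hF : ∀ f ∈ F, Measurable f)
    (hL0 : ∀ v y, 0 ≤ L v y) (hL : ∀ y, LipschitzWith ρ (fun v => L v y)) {C : ℝ} (hC0 : 0 < C)
    (hFC : ∀ f ∈ F, ∀ x y, L (f x) y ≤ C) {f₀ : X → EuclideanSpace ℝ (Fin k)} (hf₀ : f₀ ∈ F)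
    {u : ℕ → X → EuclideanSpace ℝ (Fin k)} (hu : ∀ a, u a ∈ F) {j : ℕ}
    (hj : j ∈ Finset.Icc 1 (k - 1)) {m : ℕ} (hm : 0 < m) {δ : ℝ} (hδ : 0 < δ) (hδ1 : δ < 1) :
    Measure.pi (fun _ : Fin m => condLaw D j)
        {z | ∃ a, ¬ ENNReal.ofReal (deviation L D j f₀ (u a) z) ≤ sizeBound D F ρ C δ j m}
      ≤ ENNReal.ofReal (δ / (2 * ((k : ℝ) - 1))) := by
  have := isProbabilityMeasure_condLaw D hj
  by_cases htop : sizeBound D F ρ C δ j m = ∞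
  · simp [htop]
  have hm' : (0 : ℝ) < m := Nat.cast_pos.2 hm
  have hjk : (j : ℝ) + 1 ≤ k := by
    have := Finset.mem_Icc.1 hj
    exact_mod_cast (by omega : j + 1 ≤ k)
  -- Exhaustion by initial segments of the sequence: the bound for each finite segment does not
  -- depend on its length.
  have hset : {z : Fin m → Example X k | ∃ a,
        ¬ ENNReal.ofReal (deviation L D j f₀ (u a) z) ≤ sizeBound D F ρ C δ j m}
      = ⋃ N : ℕ, {z | ∃ a : Fin (N + 1),
        ¬ ENNReal.ofReal (deviation L D j f₀ (u a) z) ≤ sizeBound D F ρ C δ j m} := by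
    ext z
    simp only [Set.mem_iUnion, Set.mem_ofPred_eq]
    exact ⟨fun ⟨a, ha⟩ => ⟨a, Fin.last a, ha⟩, fun ⟨N, a, ha⟩ => ⟨a, ha⟩⟩
  have hmono : Monotone fun N : ℕ => {z : Fin m → Example X k | ∃ a : Fin (N + 1),
      ¬ ENNReal.ofReal (deviation L D j f₀ (u a) z) ≤ sizeBound D F ρ C δ j m} := by
    rintro N N' hN z ⟨a, ha⟩
    exact ⟨Fin.castLE (by omega) a, ha⟩
  rw [hset, hmono.measure_iUnion]
  refine iSup_le fun N => ?_
  have hm1 : ∀ a : Fin (N + 1), Measurable (excess L j f₀ (u a)) := fun a =>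
    (measurable_sizedLoss hL (hF _ (hu a)) j).sub (measurable_sizedLoss hL (hF _ hf₀) j)
  set W : ℝ := (2 * (k : ℝ) - 2 * j - 1) * C with hW
  have hW0 : 0 < W := mul_pos (by linarith) hC0
  have hB1 : ∀ (a : Fin (N + 1)) z, |excess L j f₀ (u a) z| ≤ W := fun a z =>
    abs_excess_le hL0 hC0.le (hFC _ hf₀) (hFC _ (hu a)) hj z
  have hmean : ∀ a : ℕ, ∫ x, excess L j f₀ (u a) x ∂(condLaw D j)
      = risk L D (u a) - risk L D f₀ := fun a => by
    have hi : ∀ f ∈ F, Integrable (sizedLoss L j f) (condLaw D j) := fun f hf =>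
      integrable_of_abs_le (measurable_sizedLoss hL (hF f hf) j)
        (abs_sizedLoss_le (fun _ _ => hL0 _ _) (hFC f hf) hC0.le hj)
    unfold excess
    rw [integral_sub (hi _ (hu a)) (hi _ hf₀),
      integral_sizedLoss D hL (hF _ (hu a)) (fun _ _ => hL0 _ _) (hFC _ (hu a)) hC0.le hj,
      integral_sizedLoss D hL (hF _ hf₀) (fun _ _ => hL0 _ _) (hFC _ hf₀) hC0.le hj]
  set Φ : (Fin m → Example X k) → ℝ := fun z => ⨆ a : Fin (N + 1),
    ∑ l, ((∫ x, excess L j f₀ (u a) x ∂(condLaw D j)) - excess L j f₀ (u a) (z l)) with hΦ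
  have hΦm : Measurable Φ := Measurable.iSup fun a => by
    have := hm1 a
    fun_prop
  have hΦB : ∀ z, |Φ z| ≤ m * (W + W) := fun z => abs_iSup_le fun a =>
    (Finset.abs_sum_le_sum_abs _ _).trans ((Finset.sum_le_sum fun l _ =>
      (abs_sub _ _).trans (add_le_add (abs_integral_le_of_abs_le (hB1 a)) (hB1 a _))).trans
      (by rw [Finset.sum_const, Finset.card_univ, Fintype.card_fin, nsmul_eq_mul]))
  -- Changing one example moves one term of each sum, between two values in `[-W, W]`.
  have hΦc : ∀ l z z', (∀ i, i ≠ l → z i = z' i) → Φ z - Φ z' ≤ 2 * W := fun l z z' hz => by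
    rw [sub_le_iff_le_add]
    refine ciSup_le fun a => ?_
    have h1 := le_iSup_fin (fun a : Fin (N + 1) => ∑ l,
      ((∫ x, excess L j f₀ (u a) x ∂(condLaw D j)) - excess L j f₀ (u a) (z' l))) a
    have h2 : ∑ i, ((∫ x, excess L j f₀ (u a) x ∂(condLaw D j)) - excess L j f₀ (u a) (z i))
        - ∑ i, ((∫ x, excess L j f₀ (u a) x ∂(condLaw D j)) - excess L j f₀ (u a) (z' i))
        ≤ 2 * W := by
      rw [← Finset.sum_sub_distrib, Finset.sum_eq_single l (fun i _ hi => by rw [hz i hi, sub_self])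
        (fun h => absurd (Finset.mem_univ l) h)]
      linarith [abs_le.1 (hB1 a (z l)), abs_le.1 (hB1 a (z' l))]
    linarith
  have hmcd := measure_ge_le_of_bounded_differences (condLaw D j) (c := 2 * W) (by positivity) hm
    hΦm hΦB hΦc (t := devConst k j C δ * √m)
    (mul_nonneg (devConst_pos hj hC0 hδ hδ1).le (Real.sqrt_nonneg _))
  rw [exp_neg_devConst hj hm hC0 hδ hδ1] at hmcd
  refine (measure_mono ?_).trans hmcd
  rintro z ⟨a, ha⟩
  have hE := ofReal_integral_iSup_excess_le D hF hL0 hL hC0.le hFC hf₀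
    (u := fun a : Fin (N + 1) => u a) (fun a => hu a) hj hm
  have hE2 : ENNReal.ofReal ((∫ z, Φ z ∂(Measure.pi fun _ : Fin m => condLaw D j))
      + devConst k j C δ * √m) ≤ m * sizeBound D F ρ C δ j m := by
    refine ENNReal.ofReal_add_le.trans ?_
    rw [sizeBound, mul_add]
    refine add_le_add (hE.trans ?_) ?_
    · rw [mul_left_comm]
      gcongr
      exact contraction_const_le hj
    · rw [← ENNReal.ofReal_div_of_pos (by positivity), ← ENNReal.ofReal_natCast,
        ← ENNReal.ofReal_mul hm'.le]
      refine ENNReal.ofReal_le_ofReal (le_of_eq ?_)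
      have hs : √(m : ℝ) * √m = m := Real.mul_self_sqrt hm'.le
      have hs0 : √(m : ℝ) ≠ 0 := by positivity
      field_simp
      rw [sq, hs]
  have h1 : Φ z ≥ m * deviation L D j f₀ (u a) z := by
    refine le_trans (le_of_eq ?_) (le_iSup_fin (fun a : Fin (N + 1) => ∑ l,
      ((∫ x, excess L j f₀ (u a) x ∂(condLaw D j)) - excess L j f₀ (u a) (z l))) a)
    simp only [hmean, deviation]
    rw [Finset.sum_sub_distrib, Finset.sum_const, Finset.card_univ, Fintype.card_fin, nsmul_eq_mul]
    field_simp
  have h2 : m * sizeBound D F ρ C δ j m < ENNReal.ofReal (m * deviation L D j f₀ (u a) z) := by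
    rw [ENNReal.ofReal_mul hm'.le, ENNReal.ofReal_natCast]
    exact (ENNReal.mul_lt_mul_iff_right (by positivity) (ENNReal.natCast_ne_top m)).2 (not_le.1 ha)
  have h3 := (lt_of_not_ge fun h => (ENNReal.ofReal_le_ofReal h).not_gt (hE2.trans_lt h2)).le
  exact h3.trans h1

end Deviation

end MCL

/-! ### Limits of functions and pointwise separable classes. -/

namespace MCL

variable {X : Type*} [MeasurableSpace X] {k : ℕ} {L : EuclideanSpace ℝ (Fin k) → Fin k → ℝ}
  {ρ : ℝ≥0}

lemma tendsto_risk (D : Measure (X × Fin k)) [IsProbabilityMeasure D]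
    (hL0 : ∀ v y, 0 ≤ L v y) (hL : ∀ y, LipschitzWith ρ (fun v => L v y)) {C : ℝ}
    {v : ℕ → X → EuclideanSpace ℝ (Fin k)} (hv : ∀ i, Measurable (v i))
    (hvC : ∀ i x y, L (v i x) y ≤ C) {f : X → EuclideanSpace ℝ (Fin k)}
    (hlim : ∀ x, Tendsto (fun i => v i x) atTop (𝓝 (f x))) :
    Tendsto (fun i => risk L D (v i)) atTop (𝓝 (risk L D f)) := by
  unfold risk
  refine tendsto_integral_of_dominated_convergence (fun _ => C) (fun i => ?_)
    (integrable_const C) (fun i => ae_of_all _ fun z => ?_) (ae_of_all _ fun z => ?_)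
  · exact (measurable_from_prod_countable_left fun y =>
      measurable_loss hL (hv i) y : Measurable fun z : X × Fin k =>
        L (v i z.1) z.2).aestronglyMeasurable
  · rw [Real.norm_of_nonneg (hL0 _ _)]
    exact hvC _ _ _
  · exact ((hL z.2).continuous.tendsto _).comp (hlim z.1)

lemma tendsto_sizedLoss {X : Type*} (hL : ∀ y, LipschitzWith ρ (fun v => L v y)) (j : ℕ)
    {v : ℕ → X → EuclideanSpace ℝ (Fin k)} {f : X → EuclideanSpace ℝ (Fin k)}
    (hlim : ∀ x, Tendsto (fun i => v i x) atTop (𝓝 (f x))) (z : Example X k) :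
    Tendsto (fun i => sizedLoss L j (v i) z) atTop (𝓝 (sizedLoss L j f z)) := by
  have h : ∀ y, Tendsto (fun i => L (v i z.1) y) atTop (𝓝 (L (f z.1) y)) := fun y =>
    ((hL y).continuous.tendsto _).comp (hlim z.1)
  unfold sizedLoss
  split_ifs
  · exact (tendsto_finsetSum _ fun y _ => h y).sub
      ((tendsto_finsetSum _ fun y _ => h y).const_mul _)
  · exact tendsto_const_nhds

/-- Uniform deviation bound for a pointwise separable class. -/
theorem measure_exists_mem_deviation_le (D : Measure (X × Fin k)) [IsProbabilityMeasure D]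
    {F : Set (X → EuclideanSpace ℝ (Fin k))} (hF : ∀ f ∈ F, Measurable f)
    (hFsep : PointwiseSeparable F)
    (hL0 : ∀ v y, 0 ≤ L v y) (hL : ∀ y, LipschitzWith ρ (fun v => L v y)) {C : ℝ} (hC0 : 0 < C)
    (hFC : ∀ f ∈ F, ∀ x y, L (f x) y ≤ C) {f₀ : X → EuclideanSpace ℝ (Fin k)} (hf₀ : f₀ ∈ F)
    {j : ℕ} (hj : j ∈ Finset.Icc 1 (k - 1)) {m : ℕ} (hm : 0 < m) {δ : ℝ} (hδ : 0 < δ)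
    (hδ1 : δ < 1) :
    Measure.pi (fun _ : Fin m => condLaw D j)
        {z | ∃ f ∈ F, ¬ ENNReal.ofReal (deviation L D j f₀ f z) ≤ sizeBound D F ρ C δ j m}
      ≤ ENNReal.ofReal (δ / (2 * ((k : ℝ) - 1))) := by
  obtain ⟨F₀, hF₀F, hF₀c, hF₀⟩ := hFsep
  have hne : F₀.Nonempty := by
    obtain ⟨v, hv, -⟩ := hF₀ f₀ hf₀
    exact ⟨v 0, hv 0⟩
  obtain ⟨u, rfl⟩ := hF₀c.exists_eq_range hne
  refine (measure_mono ?_).trans (measure_exists_deviation_le D hF hL0 hL hC0 hFC hf₀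
    (fun a => hF₀F ⟨a, rfl⟩) hj hm hδ hδ1)
  rintro z ⟨f, hf, hbad⟩
  by_contra hcon
  have hgood : ∀ a, ENNReal.ofReal (deviation L D j f₀ (u a) z) ≤ sizeBound D F ρ C δ j m := by
    intro a
    by_contra ha
    exact hcon ⟨a, ha⟩
  obtain ⟨v, hv, hlim⟩ := hF₀ f hf
  -- For a fixed sample the deviation is continuous along pointwise limits, the risk by dominated
  -- convergence, so the non-strict bound passes to the limit.
  refine hbad (le_of_tendsto' (ENNReal.tendsto_ofReal (f := atTop)
    (m := fun i => deviation L D j f₀ (v i) z) ?_) fun i => ?_)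
  · unfold deviation excess
    exact ((tendsto_risk D hL0 hL (fun i => hF _ (hF₀F (hv i))) (fun i => hFC _ (hF₀F (hv i)))
      hlim).sub_const _).sub ((tendsto_finsetSum _ fun l _ =>
        (tendsto_sizedLoss hL j hlim (z l)).sub_const _).const_mul _)
  · obtain ⟨a, ha⟩ := hv i
    rw [← ha]
    exact hgood a

/-! ### From deviations to the estimation error. -/

lemma ofReal_sum_le {ι : Type*} (s : Finset ι) (f : ι → ℝ) :
    ENNReal.ofReal (∑ i ∈ s, f i) ≤ ∑ i ∈ s, ENNReal.ofReal (f i) :=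
  Finset.le_sum_of_subadditive _ ENNReal.ofReal_zero.le (fun _ _ => ENNReal.ofReal_add_le) _ _

/-- The examples of a sample with prescribed size of the label set. -/
def sizeIndices {n : ℕ} (s : Fin n → ℕ) (j : ℕ) : Finset (Fin n) :=
  Finset.univ.filter fun i => s i = j

/-- The subsample of examples with prescribed size of the label set. -/
noncomputable def subsample {Z : Type*} {n : ℕ} (s : Fin n → ℕ) (j : ℕ) (S : Fin n → Z) :
    Fin (sizeIndices s j).card → Z :=
  fun l => S ((sizeIndices s j).equivFin.symm l)

lemma sum_subsample {Z : Type*} {n : ℕ} (s : Fin n → ℕ) (j : ℕ) (S : Fin n → Z) (g : Z → ℝ) :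
    ∑ l, g (subsample s j S l) = ∑ i ∈ sizeIndices s j, g (S i) := by
  rw [← Finset.sum_coe_sort (sizeIndices s j)]
  exact Equiv.sum_comp (sizeIndices s j).equivFin.symm fun i => g (S i)

lemma filter_card_eq_sizeIndices {X : Type*} {n : ℕ} {s : Fin n → ℕ} {S : Fin n → Example X k}
    (hS : ∀ i, (S i).2.card = s i) (j : ℕ) :
    Finset.univ.filter (fun i => (S i).2.card = j) = sizeIndices s j := by
  simp only [hS, sizeIndices]

/-- The deterministic part of the argument: if all deviations are bounded, then so is the
estimation error of each minimizer of the empirical risk. -/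
lemma estimation_error_le {n : ℕ} {D : Measure (X × Fin k)}
    {F : Set (X → EuclideanSpace ℝ (Fin k))} {C : ℝ} (hC0 : 0 < C)
    {f₀ : X → EuclideanSpace ℝ (Fin k)} (hf₀ : f₀ ∈ F) {δ : ℝ} (hδ : 0 < δ) (hδ1 : δ < 1)
    {s : Fin n → ℕ} {w : ℕ → ℝ≥0} (hw : ∑ j ∈ Finset.Icc 1 (k - 1), w j = 1)
    {S : Fin n → Example X k} (hS : ∀ i, (S i).2.card = s i)
    (hdev : ∀ j ∈ Finset.Icc 1 (k - 1), 0 < (sizeIndices s j).card → ∀ f ∈ F,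
      ENNReal.ofReal (deviation L D j f₀ f (subsample s j S))
        ≤ sizeBound D F ρ C δ j (sizeIndices s j).card)
    {f : X → EuclideanSpace ℝ (Fin k)} (hf : f ∈ F) (hmin : IsMinOn (empRisk L w S) F f) :
    ENNReal.ofReal (risk L D f - risk L D f₀) ≤ errorBound D F ρ C δ w S := by
  have hcount : ∀ j, sizeCount S j = (sizeIndices s j).card := fun j => by
    rw [sizeCount, filter_card_eq_sizeIndices hS]
  have hbound : errorBound D F ρ C δ w S = ∑ j ∈ Finset.Icc 1 (k - 1),
      (w j : ℝ≥0∞) * sizeBound D F ρ C δ j (sizeIndices s j).card := by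
    simp only [errorBound, sizeBound, hcount]
  rw [hbound]
  -- A size of positive weight without examples makes the bound infinite, since a positive
  -- `devConst` is divided by `0` in `ℝ≥0∞`.
  by_cases hz : ∃ j ∈ Finset.Icc 1 (k - 1), w j ≠ 0 ∧ (sizeIndices s j).card = 0
  · obtain ⟨j, hj, hwj, hj0⟩ := hz
    refine le_top.trans (le_of_eq_of_le ?_ (Finset.single_le_sum (fun _ _ => zero_le) hj))
    have : sizeBound D F ρ C δ j (sizeIndices s j).card = ∞ := by
      rw [sizeBound, hj0, Nat.cast_zero, Real.sqrt_zero, ENNReal.ofReal_zero, ENNReal.div_zero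
        (ENNReal.ofReal_pos.2 (devConst_pos hj hC0 hδ hδ1)).ne', add_top]
    rw [this, ENNReal.mul_top (by exact_mod_cast hwj)]
  push Not at hz
  have hemp : ∀ g : X → EuclideanSpace ℝ (Fin k), empRisk L w S g
      = ∑ j ∈ Finset.Icc 1 (k - 1), (w j : ℝ) * ((1 / ((sizeIndices s j).card : ℝ)) *
        ∑ l, sizedLoss L j g (subsample s j S l)) := fun g => by
    unfold empRisk
    refine Finset.sum_congr rfl fun j _ => ?_
    rw [hcount, filter_card_eq_sizeIndices hS, sum_subsample, div_eq_mul_one_div, mul_assoc]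
    congr 2
    refine Finset.sum_congr rfl fun i hi => ?_
    rw [sizedLoss, if_pos ((hS i).trans (Finset.mem_filter.1 hi).2)]
  have hw' : ∑ j ∈ Finset.Icc 1 (k - 1), (w j : ℝ) = 1 := by exact_mod_cast hw
  have hle : risk L D f - risk L D f₀ ≤ ∑ j ∈ Finset.Icc 1 (k - 1),
      (w j : ℝ) * deviation L D j f₀ f (subsample s j S) := by
    -- As the weights sum to `1`, the weighted deviations equal the excess risk minus the empirical
    -- excess risk, and the latter is at most `0` for a minimizer.
    have h1 : empRisk L w S f ≤ empRisk L w S f₀ := hmin hf₀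
    rw [hemp, hemp] at h1
    have h2 : ∑ j ∈ Finset.Icc 1 (k - 1), (w j : ℝ) * deviation L D j f₀ f (subsample s j S)
        = (risk L D f - risk L D f₀)
          - (∑ j ∈ Finset.Icc 1 (k - 1), (w j : ℝ) * ((1 / ((sizeIndices s j).card : ℝ)) *
              ∑ l, sizedLoss L j f (subsample s j S l))
            - ∑ j ∈ Finset.Icc 1 (k - 1), (w j : ℝ) * ((1 / ((sizeIndices s j).card : ℝ)) *
              ∑ l, sizedLoss L j f₀ (subsample s j S l))) := by
      have e : risk L D f - risk L D f₀
          = ∑ j ∈ Finset.Icc 1 (k - 1), (w j : ℝ) * (risk L D f - risk L D f₀) := by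
        rw [← Finset.sum_mul, hw', one_mul]
      rw [e, ← Finset.sum_sub_distrib, ← Finset.sum_sub_distrib]
      refine Finset.sum_congr rfl fun j _ => ?_
      simp only [deviation, excess, Finset.sum_sub_distrib]
      ring
    rw [h2]
    linarith
  refine (ENNReal.ofReal_le_ofReal hle).trans ((ofReal_sum_le _ _).trans
    (Finset.sum_le_sum fun j hj => ?_))
  rw [ENNReal.ofReal_mul (w j).coe_nonneg]
  by_cases hwj : w j = 0
  · simp [hwj]
  · have e : ENNReal.ofReal (w j : ℝ) = (w j : ℝ≥0∞) := ENNReal.ofReal_coe_nnreal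
    refine (mul_le_mul_left e.le _).trans ?_
    exact mul_le_mul_right (hdev j hj (Nat.pos_of_ne_zero (hz j hj hwj)) f hf) _

/-! ### Samples with prescribed sizes of the label sets. -/

section Prescribed

variable {n : ℕ} (D : Measure (X × Fin k)) [IsProbabilityMeasure D]

lemma ae_card_eq {s : Fin n → ℕ} (hs : ∀ i, s i ∈ Finset.Icc 1 (k - 1)) :
    Measure.pi (fun i => condLaw D (s i)) {S | ∃ i, (S i).2.card ≠ s i} = 0 := by
  have hp : ∀ i, IsProbabilityMeasure (condLaw D (s i)) := fun i =>
    isProbabilityMeasure_condLaw D (hs i)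
  have e : {S : Fin n → Example X k | ∃ i, (S i).2.card ≠ s i}
      = ⋃ i, {S | (S i).2.card ≠ s i} := by
    ext S
    simp
  rw [e, measure_iUnion_null_iff]
  intro i
  have hle := Measure.le_map_apply (μ := Measure.pi fun i => condLaw D (s i))
    (measurable_pi_apply i).aemeasurable {z : Example X k | z.2.card ≠ s i}
  have hmap := (measurePreserving_eval (fun i => condLaw D (s i)) i).map_eq
  refine nonpos_iff_eq_zero.1 (hle.trans ?_)
  refine (le_of_eq (congrArg (fun ν => ν {z : Example X k | z.2.card ≠ s i}) hmap)).trans ?_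
  exact (condLaw_card_ne D).le

variable {F : Set (X → EuclideanSpace ℝ (Fin k))} (hF : ∀ f ∈ F, Measurable f)
  (hFsep : PointwiseSeparable F) (hL0 : ∀ v y, 0 ≤ L v y)
  (hL : ∀ y, LipschitzWith ρ (fun v => L v y)) {C : ℝ} (hC0 : 0 ≤ C)
  (hFC : ∀ f ∈ F, ∀ x y, L (f x) y ≤ C) {f₀ : X → EuclideanSpace ℝ (Fin k)} (hf₀ : f₀ ∈ F)
  {δ : ℝ} (hδ : 0 < δ) {s : Fin n → ℕ} (hs : ∀ i, s i ∈ Finset.Icc 1 (k - 1))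

include hF hFsep hL0 hL hC0 hFC hf₀ hδ hs

theorem pi_condLaw_failure_le {w : ℕ → ℝ≥0} (hw : ∑ j ∈ Finset.Icc 1 (k - 1), w j = 1) :
    Measure.pi (fun i => condLaw D (s i)) (failure n L D F ρ C δ w f₀) ≤ ENNReal.ofReal δ := by
  have hp : ∀ i, IsProbabilityMeasure (condLaw D (s i)) := fun i =>
    isProbabilityMeasure_condLaw D (hs i)
  rcases le_or_gt 1 δ with hδ1 | hδ1
  · refine prob_le_one.trans ?_
    rw [← ENNReal.ofReal_one]
    exact ENNReal.ofReal_le_ofReal hδ1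
  -- If `C = 0`, all risks vanish; this is treated apart because an empty size class then no longer
  -- makes the bound infinite.
  rcases hC0.eq_or_lt with rfl | hC0
  · have hempty : failure n L D F ρ 0 δ w f₀ = ∅ := by
      refine Set.eq_empty_iff_forall_notMem.2 ?_
      rintro S ⟨f, hf, -, hbad⟩
      have hr : ∀ g ∈ F, risk L D g = 0 := fun g hg => by
        have : ∀ z : X × Fin k, L (g z.1) z.2 = 0 := fun z =>
          le_antisymm (hFC g hg _ _) (hL0 _ _)
        simp [risk, this]
      rw [hr f hf, hr f₀ hf₀] at hbad
      simp at hbad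
    rw [hempty, measure_empty]
    exact zero_le
  set P := Measure.pi fun i => condLaw D (s i) with hP
  set bad : ℕ → Set (Fin n → Example X k) := fun j => {S | 0 < (sizeIndices s j).card ∧ ∃ f ∈ F,
      ¬ ENNReal.ofReal (deviation L D j f₀ f (subsample s j S))
        ≤ sizeBound D F ρ C δ j (sizeIndices s j).card} with hbad
  have hsub : failure n L D F ρ C δ w f₀
      ⊆ {S | ∃ i, (S i).2.card ≠ s i} ∪ ⋃ j ∈ Finset.Icc 1 (k - 1), bad j := by
    rintro S ⟨f, hf, hmin, hfail⟩
    by_contra hcon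
    simp only [Set.mem_union, Set.mem_iUnion, not_or, not_exists] at hcon
    obtain ⟨h1, h2⟩ := hcon
    refine hfail (estimation_error_le (s := s) hC0 hf₀ hδ hδ1 hw (fun i => ?_)
      (fun j hj hpos g hg => ?_) hf hmin)
    · by_contra hi
      exact h1 ⟨i, hi⟩
    · by_contra hg'
      exact h2 j hj ⟨hpos, g, hg, hg'⟩
  have hbadP : ∀ j ∈ Finset.Icc 1 (k - 1), P (bad j) ≤ ENNReal.ofReal (δ / (2 * ((k : ℝ) - 1))) := by
    intro j hj
    by_cases hpos : 0 < (sizeIndices s j).card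
    · have hmp := measurePreserving_pi_comp (fun i => condLaw D (s i))
        (e := fun l => (((sizeIndices s j).equivFin.symm l : sizeIndices s j) : Fin n))
        (Subtype.val_injective.comp (Equiv.injective _))
      have hs' : ∀ l, s (((sizeIndices s j).equivFin.symm l : sizeIndices s j) : Fin n) = j :=
        fun l => (Finset.mem_filter.1 ((sizeIndices s j).equivFin.symm l).2).2
      simp only [hs'] at hmp
      -- Only this inequality between a preimage and the image measure is available, since the set
      -- is not known to be measurable; it has the right direction.
      have hle := Measure.le_map_apply (μ := P) hmp.measurable.aemeasurable
        {z | ∃ f ∈ F, ¬ ENNReal.ofReal (deviation L D j f₀ f z)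
          ≤ sizeBound D F ρ C δ j (sizeIndices s j).card}
      rw [hmp.map_eq] at hle
      refine (measure_mono ?_).trans (hle.trans
        (measure_exists_mem_deviation_le D hF hFsep hL0 hL hC0 hFC hf₀ hj hpos hδ hδ1))
      rintro S ⟨-, hS⟩
      exact hS
    · have : bad j = ∅ := Set.eq_empty_iff_forall_notMem.2 fun S hS => hpos hS.1
      rw [this, measure_empty]
      exact zero_le
  have hk : (1 : ℝ) ≤ (k : ℝ) - 1 := by
    have hne : (Finset.Icc 1 (k - 1)).Nonempty := by
      by_contra h
      rw [Finset.not_nonempty_iff_eq_empty.1 h, Finset.sum_empty] at hw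
      exact zero_ne_one hw
    have := Finset.nonempty_Icc.1 hne
    have h2 : ((2 : ℕ) : ℝ) ≤ k := by exact_mod_cast (by omega : 2 ≤ k)
    push_cast at h2
    linarith
  -- Union bound over the `k - 1` sizes, with the null set of samples of wrong sizes set aside.
  calc P (failure n L D F ρ C δ w f₀)
      ≤ P {S | ∃ i, (S i).2.card ≠ s i} + P (⋃ j ∈ Finset.Icc 1 (k - 1), bad j) :=
        (measure_mono hsub).trans (measure_union_le _ _)
    _ ≤ 0 + ∑ j ∈ Finset.Icc 1 (k - 1), ENNReal.ofReal (δ / (2 * ((k : ℝ) - 1))) :=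
        add_le_add (ae_card_eq D hs).le
          ((measure_biUnion_finset_le _ _).trans (Finset.sum_le_sum hbadP))
    _ = ENNReal.ofReal (((k - 1 : ℕ) : ℝ) * (δ / (2 * ((k : ℝ) - 1)))) := by
        rw [zero_add, Finset.sum_const, Nat.card_Icc, nsmul_eq_mul,
          ENNReal.ofReal_mul (Nat.cast_nonneg _), ENNReal.ofReal_natCast, Nat.add_sub_cancel]
    _ ≤ ENNReal.ofReal δ := by
        refine ENNReal.ofReal_le_ofReal ?_
        have h1 : 1 ≤ k := by
          by_contra h
          have : k = 0 := by omega
          subst this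
          norm_num at hk
        rw [Nat.cast_sub h1, Nat.cast_one]
        have : (k : ℝ) - 1 ≠ 0 := by linarith
        field_simp
        linarith

theorem pi_condLaw_pluginFailure_le (hn : 0 < n) :
    Measure.pi (fun i => condLaw D (s i)) (pluginFailure n L D F ρ C δ f₀)
      ≤ ENNReal.ofReal δ := by
  have hn' : (n : ℝ≥0) ≠ 0 := by exact_mod_cast hn.ne'
  -- These weights do not depend on the sample, and almost surely they coincide with `sizeFreq S`.
  set w : ℕ → ℝ≥0 := fun j => ((sizeIndices s j).card : ℝ≥0) / n with hwdef
  have hw : ∑ j ∈ Finset.Icc 1 (k - 1), w j = 1 := by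
    have h := Finset.card_eq_sum_card_fiberwise (s := (Finset.univ : Finset (Fin n)))
      (t := Finset.Icc 1 (k - 1)) (f := s) fun i _ => hs i
    rw [Finset.card_univ, Fintype.card_fin] at h
    simp only [hwdef]
    rw [← Finset.sum_div, div_eq_one_iff_eq hn']
    exact_mod_cast h.symm
  have hsub : pluginFailure n L D F ρ C δ f₀
      ⊆ {S | ∃ i, (S i).2.card ≠ s i} ∪ failure n L D F ρ C δ w f₀ := by
    rintro S ⟨f, hf, hmin, hfail⟩
    by_cases hS : ∃ i, (S i).2.card ≠ s i
    · exact Or.inl hS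
    right
    push Not at hS
    have hfreq : sizeFreq S = w := by
      funext j
      rw [sizeFreq, sizeCount, filter_card_eq_sizeIndices hS]
    have hrisk : pluginRisk L S = empRisk L w S := by
      funext g
      unfold pluginRisk empRisk
      rw [← Finset.sum_fiberwise_of_maps_to (s := (Finset.univ : Finset (Fin n)))
        (t := Finset.Icc 1 (k - 1)) (g := fun i => (S i).2.card)
        (fun i _ => by rw [hS]; exact hs i), Finset.mul_sum]
      refine Finset.sum_congr rfl fun j _ => ?_
      rw [sizeCount, filter_card_eq_sizeIndices hS]
      by_cases h0 : (sizeIndices s j).card = 0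
      · rw [Finset.card_eq_zero.1 h0]
        simp
      · have h0' : ((sizeIndices s j).card : ℝ) ≠ 0 := by exact_mod_cast h0
        congr 1
        simp only [hwdef, NNReal.coe_div, NNReal.coe_natCast]
        field_simp
    refine ⟨f, hf, ?_, ?_⟩
    · rw [← hrisk]
      exact hmin
    · rw [← hfreq]
      exact hfail
  calc _ ≤ Measure.pi (fun i => condLaw D (s i)) {S | ∃ i, (S i).2.card ≠ s i}
          + Measure.pi (fun i => condLaw D (s i)) (failure n L D F ρ C δ w f₀) :=
        (measure_mono hsub).trans (measure_union_le _ _)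
    _ ≤ 0 + ENNReal.ofReal δ := add_le_add (ae_card_eq D hs).le
        (pi_condLaw_failure_le D hF hFsep hL0 hL hC0 hFC hf₀ hδ hs hw)
    _ = _ := zero_add _

end Prescribed

/-! ### Passage to i.i.d. samples and the theorem. -/

/-- A bound for all prescribed sizes of the label sets carries over to an i.i.d. sample. -/
lemma pi_sampleLaw_le {n : ℕ} (D : Measure (X × Fin k)) [IsProbabilityMeasure D] {p : ℕ → ℝ≥0}
    (hp : ∑ j ∈ Finset.Icc 1 (k - 1), p j = 1) {A : Set (Fin n → Example X k)} {b : ℝ≥0∞}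
    (h : ∀ s : Fin n → ℕ, (∀ i, s i ∈ Finset.Icc 1 (k - 1)) →
      Measure.pi (fun i => condLaw D (s i)) A ≤ b) :
    Measure.pi (fun _ : Fin n => sampleLaw D p) A ≤ b := by
  have hfin : ∀ j ∈ Finset.Icc 1 (k - 1), IsFiniteMeasure (condLaw D j) := fun j hj => by
    have := isProbabilityMeasure_condLaw D hj
    infer_instance
  unfold sampleLaw
  rw [pi_finsetSum_smul _ _ _ hfin, Measure.finsetSum_apply]
  calc _ ≤ ∑ s ∈ Fintype.piFinset (fun _ : Fin n => Finset.Icc 1 (k - 1)),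
        ((∏ i, p (s i) : ℝ≥0) : ℝ≥0∞) * b := by
        refine Finset.sum_le_sum fun s hs => ?_
        rw [Measure.smul_apply, ENNReal.smul_def, smul_eq_mul]
        exact mul_le_mul_right (h s (Fintype.mem_piFinset.1 hs)) _
    -- The mixture weights sum to the `n`-th power of the total mass of `p`, which is `1`.
    _ = b := by
        rw [← Finset.sum_mul, ← ENNReal.ofNNReal_finsetSum,
          ← Finset.prod_univ_sum (fun _ : Fin n => Finset.Icc 1 (k - 1)) fun _ j => p j]
        simp [hp]

end MCL

theorem theorem4 {X : Type*} [MeasurableSpace X] {k n : ℕ} (hn : 0 < n)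
    -- the law of the ordinarily labelled data and the law of the size of the label sets
    (D : Measure (X × Fin k)) [IsProbabilityMeasure D]
    (p : ℕ → ℝ≥0) (hp : ∑ j ∈ Finset.Icc 1 (k - 1), p j = 1)
    -- the hypothesis class
    (F : Set (X → EuclideanSpace ℝ (Fin k))) (hF : ∀ f ∈ F, Measurable f)
    (hFsep : MCL.PointwiseSeparable F)
    -- the loss
    (L : EuclideanSpace ℝ (Fin k) → Fin k → ℝ) (hL0 : ∀ v y, 0 ≤ L v y)
    (ρ : ℝ≥0) (hρ : 0 < ρ) (hL : ∀ y, LipschitzWith ρ (fun v => L v y))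
    (C : ℝ) (hC : IsLUB {c | ∃ x : X, ∃ f ∈ F, ∃ y : Fin k, c = L (f x) y} C)
    -- the true risk minimizer
    (fstar : X → EuclideanSpace ℝ (Fin k)) (hfstar : fstar ∈ F)
    (hmin : IsMinOn (MCL.risk L D) F fstar)
    (δ : ℝ) (hδ : 0 < δ) :
    -- the sample is i.i.d.
    (Measure.pi (fun _ : Fin n => MCL.sampleLaw D p)
        (MCL.failure n L D F ρ C δ p fstar) ≤ ENNReal.ofReal δ ∧
      Measure.pi (fun _ : Fin n => MCL.sampleLaw D p)
        (MCL.pluginFailure n L D F ρ C δ fstar) ≤ ENNReal.ofReal δ) ∧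
    -- the sample is independent, with prescribed sizes of the complementary label sets
    (∀ s : Fin n → ℕ, (∀ i, s i ∈ Finset.Icc 1 (k - 1)) →
      Measure.pi (fun i : Fin n => MCL.condLaw D (s i))
        (MCL.failure n L D F ρ C δ p fstar) ≤ ENNReal.ofReal δ ∧
      Measure.pi (fun i : Fin n => MCL.condLaw D (s i))
        (MCL.pluginFailure n L D F ρ C δ fstar) ≤ ENNReal.ofReal δ) := by
  have : Nonempty (X × Fin k) := nonempty_of_isProbabilityMeasure D
  obtain ⟨x₀, y₀⟩ := this
  have hFC : ∀ f ∈ F, ∀ x y, L (f x) y ≤ C := fun f hf x y => hC.1 ⟨x, f, hf, y, rfl⟩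
  have hC0 : 0 ≤ C := (hL0 (fstar x₀) y₀).trans (hFC fstar hfstar x₀ y₀)
  have h1 : ∀ s : Fin n → ℕ, (∀ i, s i ∈ Finset.Icc 1 (k - 1)) →
      Measure.pi (fun i : Fin n => MCL.condLaw D (s i))
        (MCL.failure n L D F ρ C δ p fstar) ≤ ENNReal.ofReal δ := fun s hs =>
    MCL.pi_condLaw_failure_le D hF hFsep hL0 hL hC0 hFC hfstar hδ hs hp
  have h2 : ∀ s : Fin n → ℕ, (∀ i, s i ∈ Finset.Icc 1 (k - 1)) →
      Measure.pi (fun i : Fin n => MCL.condLaw D (s i))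
        (MCL.pluginFailure n L D F ρ C δ fstar) ≤ ENNReal.ofReal δ := fun s hs =>
    MCL.pi_condLaw_pluginFailure_le D hF hFsep hL0 hL hC0 hFC hfstar hδ hs hn
  exact ⟨⟨MCL.pi_sampleLaw_le D hp h1, MCL.pi_sampleLaw_le D hp h2⟩,
    fun s hs => ⟨h1 s hs, h2 s hs⟩⟩
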